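/- Work in Cantor space $2^\omega$ with the uniform measure $\mu$. For a set $S$ of finite binary strings let $[S]$ be the open set of all $X\in 2^\omega$ with a prefix in $S$; a c.e. open set (relative to an oracle $A$) is a set $[S]$ with $S$ c.e. (in $A$). Let $(\mathcal U_e)_{e\in\mathbb N}$ be the standard effective enumeration of all (unrelativized) c.e. open sets. For an oracle $A\in 2^\omega$: * An $A$-Martin-Löf test is a non-increasing sequence $(\mathcal V_n)_{n\in\mathbb N}$ of sets that are c.e. open relative to $A$, uniformly in $n$, with $\mu(\mathcal V_n)\le 2^{-n}$ for all $n$; it is an $A$-Schnorr test if moreover $\mu(\mathcal V_n)=2^{-n}$ for all $n$. A sequence $X$ passes a test $(\mathcal V_n)$ if $X\notin\bigcap_n\mathcal V_n$. $\mathrm{MLR}^A$ (resp. $\mathrm{SR}^A$) is the set of $X\in2^\omega$ that pass all $A$-Martin-Löf (resp. $A$-Schnorr) tests. * A martingale is a function $d:2^{<\omega}\to\mathbb R^{\ge0}$ with $d(\sigma)=\frac{d(\sigma0)+d(\sigma1)}2$ for all $\sigma$; it succeeds on $X$ if $\limsup_n d(X\upharpoonright n)=+\infty$. $\mathrm{CR}^A$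 is the set of $X\in 2^\omega$ on which no martingale succeeds that is $A$-computable as a real-valued function. * $\mathrm{MLR}$, $\mathrm{CR}$, $\mathrm{SR}$ denote the unrelativized classes. * For an oracle $Z$, $\mathrm{MLR}[Z]$ is the set of $X\in 2^\omega$ that pass every sequence $(\mathcal U_{f(n)})_{n\in\mathbb N}$ such that $f:\mathbb N\to\mathbb N$ is $Z$-computable and $\mu(\mathcal U_{f(n)})\le2^{-n}$ for all $n$. * $\mathrm{Low}(\mathrm{MLR})=\{A\in 2^\omega:\mathrm{MLR}^A=\mathrm{MLR}\}$, and, for a class $\mathscr R\subseteq 2^\omega$ and $\mathscr S\in\{\mathrm{MLR},\mathrm{CR},\mathrm{SR}\}$, $\mathrm{Low}(\mathscr R,\mathscr S)=\{A\in 2^\omega:\mathscr R\subseteq\mathscr S^A\}$. **Proposition.** For every $Z\in2^\omega$: (i) $\mathrm{Low}(\mathrm{MLR}[Z],\mathrm{MLR})=\mathrm{Low}(\mathrm{MLR})$; (ii) $\mathrm{Low}(\mathrm{MLR}[Z],\mathrm{CR})=\mathrm{Low}(\mathrm{MLR},\mathrm{CR})$; (iii) $\mathrm{Low}(\mathrm{MLR}[Z],\mathrm{SR})=\mathrm{Low}(\mathrm{MLR},\mathrm{SR})$.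 -/

import Mathlib

open MeasureTheory Filter
open scoped ENNReal

noncomputable section

namespace Randomness

/-- Cantor space: infinite binary sequences. Oracles are also elements of this space. -/
abbrev Cantor : Type := ℕ → Bool

/-- Finite binary strings. -/
abbrev Str : Type := List Bool

/-- The prefix of `X` of length `n`. -/
def initSeg (X : Cantor) (n : ℕ) : Str := List.ofFn fun i : Fin n => X i

/-- The set of infinite sequences with prefix `σ`. -/
def cyl (σ : Str) : Set Cantor := {X | initSeg X σ.length = σ}

/-- The open set generated by a set of strings. -/
def openOf (S : Set Str) : Set Cantor := ⋃ σ ∈ S, cyl σ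

/-- The uniform (Lebesgue) measure on Cantor space: independent fair coin tosses. -/
def lam : Measure Cantor :=
  Measure.infinitePi fun _ : ℕ => (PMF.uniformOfFintype Bool).toMeasure

/-- The characteristic function of `A`, as an oracle. -/
def oracle (A : Cantor) : ℕ →. ℕ := fun n => Part.some (A n).toNat

/-! Relativized notions take a set `O` of oracles: `{oracle A}` is relativization to `A`, and `∅`
is the unrelativized notion. -/

/-- `S` is computably enumerable relative to `O`: it is the domain of a partial function that is
partial recursive in `O`. -/
def CEIn {α : Type} [Primcodable α] (O : Set (ℕ →. ℕ)) (S : Set α) : Prop :=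
  ∃ f : α →. Unit, RecursiveIn O f ∧ S = f.Dom

/-- `U` is a sequence of open sets that are c.e. open relative to `O`, uniformly in the index. -/
def UniformlyCEOpenIn (O : Set (ℕ →. ℕ)) (U : ℕ → Set Cantor) : Prop :=
  ∃ S : ℕ → Set Str, CEIn O {p : ℕ × Str | p.2 ∈ S p.1} ∧ ∀ n, U n = openOf (S n)

/-- Martin-Löf tests relative to `O`: non-increasing sequences of uniformly c.e. open sets, the
`n`-th one of measure at most `2 ^ (-n)`. -/
structure IsMLTest (O : Set (ℕ →. ℕ)) (U : ℕ → Set Cantor) : Prop where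
  antitone : Antitone U
  ce : UniformlyCEOpenIn O U
  measure_le : ∀ n, lam (U n) ≤ (2⁻¹ : ℝ≥0∞) ^ n

/-- Schnorr tests relative to `O`: Martin-Löf tests whose `n`-th set has measure exactly
`2 ^ (-n)`. -/
structure IsSchnorrTest (O : Set (ℕ →. ℕ)) (U : ℕ → Set Cantor) : Prop extends IsMLTest O U where
  measure_eq : ∀ n, lam (U n) = (2⁻¹ : ℝ≥0∞) ^ n

/-- `X` passes the test `U`. -/
def Passes (X : Cantor) (U : ℕ → Set Cantor) : Prop := X ∉ ⋂ n, U n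

/-- The Martin-Löf random sequences relative to `O`. -/
def MLR (O : Set (ℕ →. ℕ)) : Set Cantor := {X | ∀ U, IsMLTest O U → Passes X U}

/-- The Schnorr random sequences relative to `O`. -/
def SR (O : Set (ℕ →. ℕ)) : Set Cantor := {X | ∀ U, IsSchnorrTest O U → Passes X U}

/-- A martingale: a non-negative real function on strings with the fairness condition. -/
structure IsMartingale (d : Str → ℝ) : Prop where
  nonneg : ∀ σ, 0 ≤ d σ
  fair : ∀ σ, d σ = (d (σ ++ [false]) + d (σ ++ [true])) / 2

/-- `d` is computable relative to `O` as a real-valued function: from `σ` and `n` one computes a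
rational number (given by numerators `a`, `b` of its positive and negative parts, and a
denominator) within `2 ^ (-n)` of `d σ`. -/
def RealComputableIn (O : Set (ℕ →. ℕ)) (d : Str → ℝ) : Prop :=
  ∃ a b c : Str × ℕ → ℕ, ComputableIn O a ∧ ComputableIn O b ∧ ComputableIn O c ∧
    ∀ σ n, |d σ - ((a (σ, n) : ℝ) - (b (σ, n) : ℝ)) / ((c (σ, n) : ℝ) + 1)| ≤ (1 / 2 : ℝ) ^ n

/-- The martingale `d` succeeds on `X`: `limsup d (X ↾ n) = ∞`. -/
def Succeeds (d : Str → ℝ) (X : Cantor) : Prop :=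
  limsup (fun n => ((d (initSeg X n) : ℝ) : EReal)) atTop = ⊤

/-- The computably random sequences relative to `O`. -/
def CR (O : Set (ℕ →. ℕ)) : Set Cantor :=
  {X | ∀ d, IsMartingale d → RealComputableIn O d → ¬ Succeeds d X}

/-- The standard effective enumeration of the c.e. open sets: the `e`-th one is generated by the
set of strings on which the `e`-th program halts. -/
def ceOpen (e : ℕ) : Set Cantor :=
  openOf {σ | ((Denumerable.ofNat Nat.Partrec.Code e).eval (Encodable.encode σ)).Dom}

/-- The tests for partially relativized Martin-Löf randomness: sequences of (unrelativized) c.e.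
open sets with a `Z`-computable sequence of indices `f`, the `n`-th of measure at most
`2 ^ (-n)`. -/
structure IsPartialMLTest (Z : Cantor) (U : ℕ → Set Cantor) : Prop where
  index : ∃ f : ℕ → ℕ, ComputableIn {oracle Z} f ∧ ∀ n, U n = ceOpen (f n)
  measure_le : ∀ n, lam (U n) ≤ (2⁻¹ : ℝ≥0∞) ^ n

/-- The class `MLR[Z]` of partially relativized Martin-Löf random sequences. -/
def PartialMLR (Z : Cantor) : Set Cantor := {X | ∀ U, IsPartialMLTest Z U → Passes X U}

/-- `Low(R)`: the oracles `A` with `R^A = R`. -/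
def Low (R : Set (ℕ →. ℕ) → Set Cantor) : Set Cantor := {A | R {oracle A} = R ∅}

/-- `Low(R, S)`: the oracles `A` with `R ⊆ S^A`. -/
def LowPair (R : Set Cantor) (S : Set (ℕ →. ℕ) → Set Cantor) : Set Cantor :=
  {A | R ⊆ S {oracle A}}

end Randomness

end

/-! Since `PartialMLR Z ⊆ MLR ∅`, one half of each equality is immediate. For the other half,
suppose that some `X ∈ MLR ∅` fails randomness relative to `A`. It suffices to build `Y ∈ PartialMLR
Z` that fails in the same sense.

Failure of `X` is first made uniform over its tails. There is an `A`-c.e. open set of measure below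
one that contains every tail of `X`. It is generated by a prefix-free `A`-c.e. set `S`, and the sets
`iter S n` of sequences starting with `n` blocks from `S` have measure `lam (openOf S) ^ n`. A
sequence made of infinitely many blocks from `S` thus fails an `A`-test.

Kučera's argument (`exists_lam_app_preimage_lt_one`) shows that no unrelativized c.e. open `M` of
measure below one covers `openOf S` up to a null set. Otherwise each string of `S` lies in the c.e.
set `W` of strings above which `M` has conditional measure more than `q`, where `lam M < q < 1`.
Then `openOf W` has measure below one and contains all tails of `X`, so iterating a prefix-free
generator of it gives an unrelativized test that captures `X`.

Hence some block of `S` always leaves room outside `M`, and `Y` is built by forcing with pairs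
(finite list of blocks, c.e. open set to avoid). The tests for `PartialMLR Z` are countably many and
each consists of unrelativized c.e. open sets, so one small member of each test can be added to the
set to avoid (`exists_mem_partialMLR`). The power of `Z` plays no role.

For Martin-Löf randomness the set of tails comes directly from the test (`tails`). For Schnorr
randomness its measure must be exactly one half, so it is filled up by lexicographic initial
segments (`exists_ceOpen_lam_eq_half`). For computable randomness a weighted sum of translates of
the martingale is unbounded on every tail of `X`; the blocks are the minimal strings on which its
approximation exceeds a bound, and a martingale that saves its profit and restarts after each block
succeeds on `Y` (`mixture`, `restart`). -/

noncomputable section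
namespace Randomness

/-! ### Initial segments -/

@[simp] theorem length_initSeg (X : Cantor) (n : ℕ) : (initSeg X n).length = n := by
  simp [initSeg]

theorem initSeg_succ (X : Cantor) (n : ℕ) : initSeg X (n + 1) = initSeg X n ++ [X n] := by
  rw [initSeg, List.ofFn_succ_last]; rfl

theorem initSeg_prefix (X : Cantor) {m n : ℕ} (h : m ≤ n) : initSeg X m <+: initSeg X n := by
  induction h with
  | refl => exact List.prefix_rfl
  | step _ ih => exact ih.trans (by rw [initSeg_succ]; exact List.prefix_append _ _)

theorem getElem?_initSeg (X : Cantor) {n i : ℕ} (h : i < n) : (initSeg X n)[i]? = some (X i) := by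
  simp [initSeg, h]

theorem take_initSeg (X : Cantor) {m n : ℕ} (h : m ≤ n) : (initSeg X n).take m = initSeg X m := by
  have := List.prefix_iff_eq_take.1 (initSeg_prefix X h)
  rw [length_initSeg] at this
  exact this.symm

theorem eq_initSeg_of_prefix {X : Cantor} {σ : Str} {n : ℕ} (h : σ <+: initSeg X n) :
    σ = initSeg X σ.length := by
  have hl : σ.length ≤ n := by simpa using h.length_le
  have := List.prefix_iff_eq_take.1 h
  rwa [take_initSeg X hl] at this

/-! ### Stagewise approximation of functions that are partial recursive in an oracle -/

/-- `f` is the limit of a primitive recursive function of longer and longer initial segments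
of the oracle `A`. -/
def HasApprox (A : Cantor) (f : ℕ → Part ℕ) : Prop :=
  ∃ g : Str → ℕ → Option ℕ, Primrec₂ g ∧
    (∀ k l n y, k ≤ l → g (initSeg A k) n = some y → g (initSeg A l) n = some y) ∧
    ∀ n y, y ∈ f n ↔ ∃ k, g (initSeg A k) n = some y

theorem HasApprox.of_primrec (A : Cantor) {f : ℕ → ℕ} (hf : Primrec f) :
    HasApprox A fun n => Part.some (f n) := by
  refine ⟨fun _ n => some (f n), ?_, ?_, ?_⟩
  · exact (Primrec.option_some.comp (hf.comp Primrec.snd)).to₂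
  · intro k l n y _ h; exact h
  · intro n y
    simp [eq_comm]

theorem HasApprox.oracle (A : Cantor) : HasApprox A (oracle A) := by
  refine ⟨fun α n => α[n]?.map Bool.toNat, ?_, ?_, ?_⟩
  · unfold Primrec₂
    refine Primrec.option_map (Primrec.list_getElem?.comp Primrec.fst Primrec.snd) ?_
    exact ((Primrec.dom_finite Bool.toNat).comp Primrec.snd).to₂
  · intro k l n y hkl h
    beta_reduce at h ⊢
    rcases lt_or_ge n k with hn | hn
    · rw [getElem?_initSeg A hn] at h
      rw [getElem?_initSeg A (hn.trans_le hkl)]; exact h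
    · rw [List.getElem?_eq_none (by simpa using hn)] at h
      simp at h
  · intro n y
    simp only [Randomness.oracle, Part.mem_some_iff]
    constructor
    · rintro rfl
      exact ⟨n + 1, by rw [getElem?_initSeg A (Nat.lt_succ_self n)]; rfl⟩
    · rintro ⟨k, hk⟩
      rcases lt_or_ge n k with hn | hn
      · rw [getElem?_initSeg A hn] at hk
        simpa [eq_comm] using hk
      · rw [List.getElem?_eq_none (by simpa using hn)] at hk
        simp at hk

theorem HasApprox.pair {A : Cantor} {f h : ℕ → Part ℕ} (hf : HasApprox A f) (hh : HasApprox A h) :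
    HasApprox A fun n => (Nat.pair <$> f n <*> h n) := by
  obtain ⟨u, hu, hum, huf⟩ := hf
  obtain ⟨v, hv, hvm, hvf⟩ := hh
  refine ⟨fun α n => (u α n).bind fun a => (v α n).map fun b => Nat.pair a b, ?_, ?_, ?_⟩
  · unfold Primrec₂
    refine Primrec.option_bind (hu.comp Primrec.fst Primrec.snd) ?_
    refine Primrec.option_map (hv.comp (Primrec.fst.comp Primrec.fst)
      (Primrec.snd.comp Primrec.fst)) ?_
    exact (Primrec₂.natPair.comp (Primrec.snd.comp Primrec.fst) Primrec.snd).to₂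
  · intro k l n y hkl
    simp only [Option.bind_eq_some_iff, Option.map_eq_some_iff]
    rintro ⟨a, ha, b, hb, rfl⟩
    exact ⟨a, hum _ _ _ _ hkl ha, b, hvm _ _ _ _ hkl hb, rfl⟩
  · intro n y
    simp only [Option.bind_eq_some_iff, Option.map_eq_some_iff, Seq.seq, Part.mem_bind_iff,
      Functor.map, Part.mem_map_iff, huf, hvf]
    constructor
    · rintro ⟨_, ⟨a, ⟨k, hk⟩, rfl⟩, b, ⟨l, hl⟩, rfl⟩
      exact ⟨max k l, a, hum _ _ _ _ (le_max_left _ _) hk, b,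
        hvm _ _ _ _ (le_max_right _ _) hl, rfl⟩
    · rintro ⟨k, a, ha, b, hb, rfl⟩
      exact ⟨_, ⟨a, ⟨k, ha⟩, rfl⟩, b, ⟨k, hb⟩, rfl⟩

theorem HasApprox.comp {A : Cantor} {f h : ℕ → Part ℕ} (hf : HasApprox A f) (hh : HasApprox A h) :
    HasApprox A fun n => h n >>= f := by
  obtain ⟨u, hu, hum, huf⟩ := hf
  obtain ⟨v, hv, hvm, hvf⟩ := hh
  refine ⟨fun α n => (v α n).bind fun a => u α a, ?_, ?_, ?_⟩
  · unfold Primrec₂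
    refine Primrec.option_bind (hv.comp Primrec.fst Primrec.snd) ?_
    exact (hu.comp (Primrec.fst.comp Primrec.fst) Primrec.snd).to₂
  · intro k l n y hkl
    simp only [Option.bind_eq_some_iff]
    rintro ⟨a, ha, hb⟩
    exact ⟨a, hvm _ _ _ _ hkl ha, hum _ _ _ _ hkl hb⟩
  · intro n y
    simp only [Option.bind_eq_some_iff, Part.bind_eq_bind, Part.mem_bind_iff, huf, hvf]
    constructor
    · rintro ⟨a, ⟨k, hk⟩, l, hl⟩
      exact ⟨max k l, a, hvm _ _ _ _ (le_max_left _ _) hk, hum _ _ _ _ (le_max_right _ _) hl⟩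
    · rintro ⟨k, a, ha, hb⟩
      exact ⟨a, ⟨k, ha⟩, k, hb⟩

theorem HasApprox.prec {A : Cantor} {f h : ℕ → Part ℕ} (hf : HasApprox A f) (hh : HasApprox A h) :
    HasApprox A fun p => (p.unpair.2.rec (f p.unpair.1) fun y IH => IH.bind fun i =>
      h (Nat.pair p.unpair.1 (Nat.pair y i)) : Part ℕ) := by
  obtain ⟨u, hu, hum, huf⟩ := hf
  obtain ⟨v, hv, hvm, hvf⟩ := hh
  -- Persistence and correctness go through one induction, because correctness at a successor merges
  -- two stages by persistence.
  have key : ∀ (a n : ℕ), 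
      (∀ k l y, k ≤ l → (n.rec (u (initSeg A k) a) fun i IH => IH.bind fun z =>
          v (initSeg A k) (Nat.pair a (Nat.pair i z)) : Option ℕ) = some y →
        (n.rec (u (initSeg A l) a) fun i IH => IH.bind fun z =>
          v (initSeg A l) (Nat.pair a (Nat.pair i z)) : Option ℕ) = some y) ∧
      ∀ y, y ∈ (n.rec (f a) fun y IH => IH.bind fun i => h (Nat.pair a (Nat.pair y i)) : Part ℕ) ↔
        ∃ k, (n.rec (u (initSeg A k) a) fun i IH => IH.bind fun z =>
          v (initSeg A k) (Nat.pair a (Nat.pair i z)) : Option ℕ) = some y := by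
    intro a n
    induction n with
    | zero => exact ⟨fun k l y hkl h => hum _ _ _ _ hkl h, fun y => huf _ _⟩
    | succ n ih =>
      refine ⟨?_, ?_⟩
      · intro k l y hkl
        simp only [Option.bind_eq_some_iff]
        rintro ⟨z, hz, hy⟩
        exact ⟨z, ih.1 _ _ _ hkl hz, hvm _ _ _ _ hkl hy⟩
      · intro y
        simp only [Option.bind_eq_some_iff, Part.mem_bind_iff, ih.2, hvf]
        constructor
        · rintro ⟨z, ⟨k, hk⟩, l, hl⟩
          exact ⟨max k l, z, ih.1 _ _ _ (le_max_left _ _) hk,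
            hvm _ _ _ _ (le_max_right _ _) hl⟩
        · rintro ⟨k, z, hz, hy⟩
          exact ⟨z, ⟨k, hz⟩, k, hy⟩
  refine ⟨fun α p => (p.unpair.2.rec (u α p.unpair.1) fun i IH => IH.bind fun z =>
    v α (Nat.pair p.unpair.1 (Nat.pair i z)) : Option ℕ), ?_, ?_, ?_⟩
  · have hup : Primrec fun q : Str × ℕ => q.2.unpair := Primrec.unpair.comp Primrec.snd
    refine Primrec.nat_rec' (Primrec.snd.comp hup)
      (hu.comp Primrec.fst (Primrec.fst.comp hup))
      (h := fun q s => s.2.bind fun z => v q.1 (Nat.pair q.2.unpair.1 (Nat.pair s.1 z))) ?_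
    unfold Primrec₂
    refine Primrec.option_bind (Primrec.snd.comp Primrec.snd) ?_
    unfold Primrec₂
    refine hv.comp (Primrec.fst.comp (Primrec.fst.comp Primrec.fst)) ?_
    exact Primrec₂.natPair.comp (Primrec.fst.comp (hup.comp (Primrec.fst.comp Primrec.fst)))
      (Primrec₂.natPair.comp (Primrec.fst.comp (Primrec.snd.comp Primrec.fst)) Primrec.snd)
  · intro k l n y hkl
    exact (key _ _).1 k l y hkl
  · intro n y
    exact (key _ _).2 y

theorem HasApprox.rfind {A : Cantor} {f : ℕ → Part ℕ} (hf : HasApprox A f) :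
    HasApprox A fun a => Nat.rfind fun n => (fun m => m = 0) <$> f (Nat.pair a n) := by
  obtain ⟨u, hu, hum, huf⟩ := hf
  -- An undefined value counts as `0`, so `getD 0 ≠ 0` says that the value has converged and is
  -- nonzero. This makes `Q` persist to later stages and gives it at most one solution `n`.
  let Q : ℕ → Str × ℕ → Prop := fun n q =>
    u q.1 (Nat.pair q.2 n) = some 0 ∧ ∀ m < n, (u q.1 (Nat.pair q.2 m)).getD 0 ≠ 0
  have hQ : PrimrecRel Q := by
    refine PrimrecPred.and ?_ ?_
    · exact Primrec.eq.comp (hu.comp (Primrec.fst.comp Primrec.snd)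
        (Primrec₂.natPair.comp (Primrec.snd.comp Primrec.snd) Primrec.fst)) (Primrec.const _)
    · have : PrimrecRel fun (m : ℕ) (q : Str × ℕ) => (u q.1 (Nat.pair q.2 m)).getD 0 ≠ 0 := by
        refine PrimrecPred.not ?_
        exact Primrec.eq.comp (Primrec.option_getD.comp (hu.comp (Primrec.fst.comp Primrec.snd)
          (Primrec₂.natPair.comp (Primrec.snd.comp Primrec.snd) Primrec.fst)) (Primrec.const _))
          (Primrec.const _)
      exact (this.forall_mem_list.comp (Primrec.list_range.comp Primrec.fst) Primrec.snd).of_eq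
        (by simp)
  have hQu : ∀ n m q, Q n q → Q m q → n = m := by
    intro n m q hn hm
    rcases lt_trichotomy n m with h | h | h
    · exact absurd (by rw [hn.1]; rfl) (hm.2 n h)
    · exact h
    · exact absurd (by rw [hm.1]; rfl) (hn.2 m h)
  classical
  have hhead : ∀ q n, ((List.range (q.1.length + 1)).filter (fun n => Q n q)).head? = some n ↔
      n ≤ q.1.length ∧ Q n q := by
    intro q n
    constructor
    · intro h
      have := List.mem_of_mem_head? h
      simpa [Nat.lt_succ_iff] using this
    · intro h
      have hmem : n ∈ (List.range (q.1.length + 1)).filter (fun n => Q n q) := by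
        simpa [Nat.lt_succ_iff] using h
      cases hl : (List.range (q.1.length + 1)).filter (fun n => Q n q) with
      | nil => rw [hl] at hmem; simp at hmem
      | cons m t =>
        have hm : m ∈ (List.range (q.1.length + 1)).filter (fun n => Q n q) := by
          rw [hl]; simp
        have hm' : Q m q := by simpa using (List.mem_filter.1 hm).2
        simp [hQu m n q hm' h.2]
  have hmono : ∀ k l a n, k ≤ l → Q n (initSeg A k, a) → Q n (initSeg A l, a) := by
    intro k l a n hkl h
    refine ⟨hum _ _ _ _ hkl h.1, fun m hm => ?_⟩
    have := h.2 m hm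
    rcases hv : u (initSeg A k) (Nat.pair a m) with _ | y
    · simp [hv] at this
    · simp only [hv, Option.getD_some] at this
      simp only [hum _ _ _ _ hkl hv, Option.getD_some]
      exact this
  refine ⟨fun α a => ((List.range (α.length + 1)).filter (fun n => Q n (α, a))).head?, ?_, ?_, ?_⟩
  · exact Primrec.list_head?.comp (hQ.listFilter.comp
      (Primrec.list_range.comp (Primrec.succ.comp (Primrec.list_length.comp Primrec.fst)))
      Primrec.id)
  · intro k l n y hkl h
    have h' := (hhead (initSeg A k, n) y).1 h
    refine (hhead (initSeg A l, n) y).2 ⟨?_, hmono _ _ _ _ hkl h'.2⟩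
    have := h'.1
    simp only [length_initSeg] at this ⊢
    exact this.trans hkl
  · intro a n
    have hh : ∀ k, ((List.range ((initSeg A k).length + 1)).filter
        (fun n => Q n (initSeg A k, a))).head? = some n ↔ n ≤ k ∧ Q n (initSeg A k, a) := by
      intro k
      simpa using hhead (initSeg A k, a) n
    change n ∈ Nat.rfind (fun n => (f (Nat.pair a n)).map fun m => decide (m = 0)) ↔ _
    simp only [hh]
    refine Iff.trans Nat.mem_rfind ?_
    simp only [Part.mem_map_iff, huf]
    constructor
    · rintro ⟨⟨z, ⟨k, hk⟩, hz⟩, h2⟩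
      have hz : z = 0 := by simpa using hz
      subst hz
      have : ∀ N ≤ n, ∃ l, ∀ m < N, (u (initSeg A l) (Nat.pair a m)).getD 0 ≠ 0 := by
        intro N
        induction N with
        | zero => intro _; exact ⟨0, by simp⟩
        | succ N ih =>
          intro hN
          obtain ⟨l, hl⟩ := ih (by omega)
          obtain ⟨z, ⟨k', hk'⟩, hz⟩ := h2 (m := N) (by omega)
          have hz : z ≠ 0 := by simpa using hz
          refine ⟨max l k', fun m hm => ?_⟩
          rcases Nat.lt_succ_iff_lt_or_eq.1 hm with h | rfl
          · have := hl m h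
            rcases hv : u (initSeg A l) (Nat.pair a m) with _ | y
            · simp [hv] at this
            · rw [hv] at this
              rw [hum _ _ _ _ (le_max_left l k') hv]; exact this
          · rw [hum _ _ _ _ (le_max_right l k') hk']; exact hz
      obtain ⟨l, hl⟩ := this n le_rfl
      refine ⟨max n (max k l), le_max_left _ _, hum _ _ _ _ (by simp) hk, fun m hm => ?_⟩
      have := hl m hm
      rcases hv : u (initSeg A l) (Nat.pair a m) with _ | y
      · simp [hv] at this
      · rw [hv] at this
        rw [hum _ _ _ _ (by simp : l ≤ max n (max k l)) hv]; exact this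
    · rintro ⟨k, -, h1, h2⟩
      refine ⟨⟨0, ⟨k, h1⟩, by simp⟩, fun {m} hm => ?_⟩
      have := h2 m hm
      rcases hv : u (initSeg A k) (Nat.pair a m) with _ | y
      · simp [hv] at this
      · exact ⟨y, ⟨k, hv⟩, by simpa [hv] using this⟩

/-- Use principle: a function partial recursive in an oracle is approximated along the initial
segments of the oracle. -/
theorem hasApprox_of_recursiveIn {A : Cantor} {f : ℕ →. ℕ}
    (hf : Nat.RecursiveIn {oracle A} f) : HasApprox A f := by
  induction hf with
  | zero => exact HasApprox.of_primrec A (Primrec.const 0)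
  | succ => exact HasApprox.of_primrec A Primrec.succ
  | left => exact HasApprox.of_primrec A (Primrec.fst.comp Primrec.unpair)
  | right => exact HasApprox.of_primrec A (Primrec.snd.comp Primrec.unpair)
  | oracle g hg => rw [Set.mem_singleton_iff.1 hg]; exact HasApprox.oracle A
  | pair _ _ ihf ihg => exact ihf.pair ihg
  | comp _ _ ihf ihg => exact ihf.comp ihg
  | prec _ _ ihf ihg => exact ihf.prec ihg
  | rfind _ ihf => exact ihf.rfind

/-! ### Sets that are computably enumerable in an oracle -/

section
variable {α β γ : Type} [Primcodable α] [Primcodable β] [Primcodable γ] {A : Cantor}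

/-- `S` is c.e. in `A`: membership is witnessed, primitive recursively, by an initial segment
of `A`. -/
def SigmaIn (A : Cantor) (S : Set α) : Prop :=
  ∃ R : Str → α → Prop, PrimrecRel R ∧ S = {x | ∃ k, R (initSeg A k) x}

/-- Searching through all prefixes of the given string makes witnesses persist, so that finitely
many of them can be merged into one stage. -/
theorem SigmaIn.exists_monotone {S : Set α} (hS : SigmaIn A S) :
    ∃ R : Str → α → Prop, PrimrecRel R ∧
      (∀ k l x, k ≤ l → R (initSeg A k) x → R (initSeg A l) x) ∧
      ∀ x, x ∈ S ↔ ∃ k, R (initSeg A k) x := by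
  obtain ⟨R, hR, rfl⟩ := hS
  refine ⟨fun α x => ∃ k ∈ List.range (α.length + 1), R (α.take k) x, ?_, ?_, ?_⟩
  · have h : PrimrecRel fun (k : ℕ) (p : Str × α) => R (p.1.take k) p.2 :=
      hR.comp (Primrec.list_take.comp Primrec.fst (Primrec.fst.comp Primrec.snd))
        (Primrec.snd.comp Primrec.snd)
    exact h.exists_mem_list.comp (Primrec.list_range.comp (Primrec.succ.comp
      (Primrec.list_length.comp Primrec.fst))) Primrec.id
  · rintro k l x hkl ⟨j, hj, h⟩
    simp only [length_initSeg, List.mem_range] at hj ⊢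
    rw [take_initSeg A (by omega)] at h
    exact ⟨j, by omega, by rwa [take_initSeg A (by omega)]⟩
  · intro x
    constructor
    · rintro ⟨k, hk⟩
      exact ⟨k, k, by simp, by rwa [take_initSeg A le_rfl]⟩
    · rintro ⟨k, j, hj, h⟩
      simp only [length_initSeg, List.mem_range] at hj
      rw [take_initSeg A (by omega)] at h
      exact ⟨j, h⟩

theorem SigmaIn.of_primrecPred {p : α → Prop} (hp : PrimrecPred p) : SigmaIn A {x | p x} :=
  ⟨fun _ x => p x, hp.comp Primrec.snd, by simp⟩

theorem SigmaIn.inter {S T : Set α} (hS : SigmaIn A S) (hT : SigmaIn A T) :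
    SigmaIn A {x | x ∈ S ∧ x ∈ T} := by
  obtain ⟨R, hR, hRm, hRS⟩ := hS.exists_monotone
  obtain ⟨Q, hQ, hQm, hQT⟩ := hT.exists_monotone
  refine ⟨fun σ x => R σ x ∧ Q σ x, PrimrecPred.and hR hQ, ?_⟩
  ext x
  simp only [Set.mem_ofPred_eq, hRS, hQT]
  constructor
  · rintro ⟨⟨k, hk⟩, l, hl⟩
    exact ⟨max k l, hRm _ _ _ (le_max_left _ _) hk, hQm _ _ _ (le_max_right _ _) hl⟩
  · rintro ⟨k, h1, h2⟩
    exact ⟨⟨k, h1⟩, k, h2⟩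

theorem SigmaIn.union {S T : Set α} (hS : SigmaIn A S) (hT : SigmaIn A T) :
    SigmaIn A {x | x ∈ S ∨ x ∈ T} := by
  obtain ⟨R, hR, rfl⟩ := hS
  obtain ⟨Q, hQ, rfl⟩ := hT
  refine ⟨fun σ x => R σ x ∨ Q σ x, PrimrecPred.or hR hQ, ?_⟩
  ext x
  simp only [Set.mem_ofPred_eq, exists_or]

theorem SigmaIn.preimage {S : Set β} (hS : SigmaIn A S) {f : α → β} (hf : Primrec f) :
    SigmaIn A {x | f x ∈ S} := by
  obtain ⟨R, hR, rfl⟩ := hS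
  exact ⟨fun σ x => R σ (f x), hR.comp Primrec.fst (hf.comp Primrec.snd), rfl⟩

/-- The length of the oracle prefix also bounds the code of the witness `y`, which turns the search
into a bounded one. -/
theorem SigmaIn.exists {S : Set (α × β)} (hS : SigmaIn A S) :
    SigmaIn A {x | ∃ y, (x, y) ∈ S} := by
  obtain ⟨R, hR, hRm, hRS⟩ := hS.exists_monotone
  refine ⟨fun σ x => ∃ k ∈ List.range (σ.length + 1),
    ∃ y ∈ (Encodable.decode (α := β) k).toList, R σ (x, y), ?_, ?_⟩
  · have h1 : PrimrecRel fun (y : β) (p : Str × α) => R p.1 (p.2, y) :=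
      hR.comp (Primrec.fst.comp Primrec.snd)
        (Primrec.pair (Primrec.snd.comp Primrec.snd) Primrec.fst)
    have h2 : PrimrecRel fun (k : ℕ) (p : Str × α) =>
        ∃ y ∈ (Encodable.decode (α := β) k).toList, R p.1 (p.2, y) :=
      h1.exists_mem_list.comp (Primrec.optionToList.comp (Primrec.decode.comp Primrec.fst))
        Primrec.snd
    exact h2.exists_mem_list.comp (Primrec.list_range.comp (Primrec.succ.comp
      (Primrec.list_length.comp Primrec.fst))) Primrec.id
  · ext x
    simp only [Set.mem_ofPred_eq, hRS, length_initSeg, List.mem_range, Option.mem_toList]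
    constructor
    · rintro ⟨y, k, hk⟩
      exact ⟨max k (Encodable.encode y), Encodable.encode y, by omega, y, by simp,
        hRm _ _ _ (le_max_left _ _) hk⟩
    · rintro ⟨k, -, -, y, -, h⟩
      exact ⟨y, k, h⟩

theorem SigmaIn.forall_mem_list {S : Set (α × β)} (hS : SigmaIn A S) :
    SigmaIn A {p : List α × β | ∀ x ∈ p.1, (x, p.2) ∈ S} := by
  obtain ⟨R, hR, hRm, hRS⟩ := hS.exists_monotone
  refine ⟨fun σ p => ∀ x ∈ p.1, R σ (x, p.2), ?_, ?_⟩
  · have h1 : PrimrecRel fun (x : α) (p : Str × β) => R p.1 (x, p.2) :=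
      hR.comp (Primrec.fst.comp Primrec.snd)
        (Primrec.pair Primrec.fst (Primrec.snd.comp Primrec.snd))
    exact h1.forall_mem_list.comp (Primrec.fst.comp Primrec.snd)
      (Primrec.pair Primrec.fst (Primrec.snd.comp Primrec.snd))
  · ext ⟨l, y⟩
    simp only [Set.mem_ofPred_eq, hRS]
    constructor
    · intro h
      induction l with
      | nil => exact ⟨0, by simp⟩
      | cons x l ih =>
        obtain ⟨k, hk⟩ := ih fun z hz => h z (List.mem_cons_of_mem _ hz)
        obtain ⟨m, hm⟩ := h x List.mem_cons_self
        refine ⟨max k m, fun z hz => ?_⟩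
        rcases List.mem_cons.1 hz with rfl | hz
        · exact hRm _ _ _ (le_max_right _ _) hm
        · exact hRm _ _ _ (le_max_left _ _) (hk z hz)
    · rintro ⟨k, hk⟩ x hx
      exact ⟨k, hk x hx⟩

/-- A predicate that is primitive recursive in an initial segment of `A` of primitive recursive
length. -/
theorem SigmaIn.of_primrecRel_initSeg {R : Str → α → Prop} (hR : PrimrecRel R) {f : α → ℕ}
    (hf : Primrec f) : SigmaIn A {x | R (initSeg A (f x)) x} := by
  refine ⟨fun σ x => R σ x ∧ σ.length = f x, PrimrecPred.and hR
    (Primrec.eq.comp (Primrec.list_length.comp Primrec.fst) (hf.comp Primrec.snd)), ?_⟩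
  ext x
  constructor
  · intro h
    exact ⟨f x, h, by simp⟩
  · rintro ⟨k, h, hk⟩
    rw [length_initSeg] at hk
    subst hk
    exact h

end

/-! ### Comparison with recursiveness in an oracle -/

section
variable {α β : Type} [Primcodable α] [Primcodable β] {A : Cantor}

theorem SigmaIn.graph_of_recursiveIn {f : α →. β} (hf : RecursiveIn {oracle A} f) :
    SigmaIn A {p : α × β | p.2 ∈ f p.1} := by
  obtain ⟨g, hg, -, hgf⟩ := hasApprox_of_recursiveIn hf
  refine ⟨fun σ p => g σ (Encodable.encode p.1) = some (Encodable.encode p.2), ?_, ?_⟩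
  · exact Primrec.eq.comp (hg.comp Primrec.fst (Primrec.encode.comp (Primrec.fst.comp Primrec.snd)))
      (Primrec.option_some.comp (Primrec.encode.comp (Primrec.snd.comp Primrec.snd)))
  · ext ⟨x, y⟩
    simp only [Set.mem_ofPred_eq, ← hgf]
    simp

theorem recursiveIn_initSeg : 
    Nat.RecursiveIn {oracle A} fun n => Part.some (Encodable.encode (initSeg A n)) := by
  -- The equality test with `1` turns the numerical answer of the oracle back into a bit.
  have hstep : Primrec fun n : ℕ => Encodable.encode
      (((Encodable.decode (α := Str) n.unpair.1).getD []) ++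
        [decide (n.unpair.2 = 1)]) := by
    refine Primrec.encode.comp (Primrec.list_append.comp (Primrec.option_getD.comp
      (Primrec.decode.comp (Primrec.fst.comp Primrec.unpair)) (Primrec.const _)) ?_)
    exact Primrec.list_cons.comp (PrimrecPred.decide (Primrec.eq.comp
      (Primrec.snd.comp Primrec.unpair) (Primrec.const 1))) (Primrec.const [])
  have h0 : Nat.RecursiveIn {oracle A} fun n => Part.some
      (Encodable.encode ((fun _ => ([] : Str)) n)) :=
    Nat.Primrec.recursiveIn (Primrec.nat_iff.1 (Primrec.encode.comp (Primrec.const _)))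
  have hy : Nat.RecursiveIn {oracle A} fun n => Part.some n.unpair.2.unpair.1 :=
    Nat.Primrec.recursiveIn (Primrec.nat_iff.1 (Primrec.fst.comp (Primrec.unpair.comp
      (Primrec.snd.comp Primrec.unpair))))
  have hi : Nat.RecursiveIn {oracle A} fun n => Part.some n.unpair.2.unpair.2 :=
    Nat.Primrec.recursiveIn (Primrec.nat_iff.1 (Primrec.snd.comp (Primrec.unpair.comp
      (Primrec.snd.comp Primrec.unpair))))
  have horc : Nat.RecursiveIn {oracle A} (oracle A) := .oracle _ rfl
  have h1 := (Nat.Primrec.recursiveIn (O := {oracle A}) (Primrec.nat_iff.1 hstep)).comp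
    (hi.pair (horc.comp hy))
  have hz : Nat.RecursiveIn {oracle A} fun n => Part.some (Nat.pair 0 n) :=
    Nat.Primrec.recursiveIn (Primrec.nat_iff.1 (Primrec₂.natPair.comp (Primrec.const 0)
      Primrec.id))
  refine ((h0.prec h1).comp hz).of_eq fun n => ?_
  simp only [Part.bind_eq_bind, Part.bind_some, Nat.unpair_pair]
  induction n with
  | zero => simp [initSeg]
  | succ n ih =>
    have hA : (Part.some n >>= oracle A) = Part.some (A n).toNat := Part.bind_some _ _
    simp only [ih, Part.bind_some, hA]
    simp [Seq.seq, initSeg_succ]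

-- This search is the single oracle program behind both converses, `ceIn_iff_sigmaIn` and
-- `computableIn_of_graph`.
open Classical in
theorem recursiveIn_search {R : Str → ℕ × α → Prop} (hR : PrimrecRel R) {h : ℕ → α → β}
    (hh : Primrec₂ h) :
    RecursiveIn {oracle A} fun a => (Nat.rfind fun m =>
      Part.some (decide (R (initSeg A m) (m, a)))).map fun m => h m a := by
  -- The input codes `((n, m), initSeg A m)`. The value `0` signals success, as unbounded search
  -- looks for zeros; an `n` that codes nothing gets `1`, so the search diverges there.
  let g : ℕ → ℕ := fun t => (Encodable.decode (α := α) t.unpair.1.unpair.1).elim 1 fun a =>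
    if R ((Encodable.decode (α := Str) t.unpair.2).getD []) (t.unpair.1.unpair.2, a) then 0 else 1
  have hg : Primrec g := by
    have h1 : Primrec fun t : ℕ => t.unpair.1.unpair :=
      Primrec.unpair.comp (Primrec.fst.comp Primrec.unpair)
    have : Primrec fun t : ℕ => (Option.casesOn (Encodable.decode (α := α) t.unpair.1.unpair.1) 1
        fun a => if R ((Encodable.decode (α := Str) t.unpair.2).getD [])
          (t.unpair.1.unpair.2, a) then 0 else 1 : ℕ) := by
      refine Primrec.option_casesOn (Primrec.decode.comp (Primrec.fst.comp h1))
        (Primrec.const 1) ?_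
      refine Primrec.ite ?_ (Primrec.const 0) (Primrec.const 1)
      refine hR.comp (Primrec.option_getD.comp (Primrec.decode.comp (Primrec.snd.comp
        (Primrec.unpair.comp Primrec.fst))) (Primrec.const _))
        (Primrec.pair (Primrec.snd.comp (h1.comp Primrec.fst)) Primrec.snd)
    refine this.of_eq fun t => ?_
    simp only [g]
    cases (Encodable.decode (α := α) t.unpair.1.unpair.1) <;> rfl
  let H : ℕ → ℕ := fun t => (Encodable.decode (α := α) t.unpair.1).elim 0 fun a =>
    Encodable.encode (h t.unpair.2 a)
  have hH : Primrec H := by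
    have : Primrec fun t : ℕ => (Option.casesOn (Encodable.decode (α := α) t.unpair.1) 0
        fun a => Encodable.encode (h t.unpair.2 a) : ℕ) := by
      refine Primrec.option_casesOn (Primrec.decode.comp (Primrec.fst.comp Primrec.unpair))
        (Primrec.const 0) ?_
      exact Primrec.encode.comp (hh.comp (Primrec.snd.comp (Primrec.unpair.comp Primrec.fst))
        Primrec.snd)
    refine this.of_eq fun t => ?_
    simp only [H]
    cases (Encodable.decode (α := α) t.unpair.1) <;> rfl
  have hid : Nat.RecursiveIn {oracle A} fun n => Part.some n :=
    Nat.Primrec.recursiveIn (Primrec.nat_iff.1 Primrec.id)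
  have hsnd : Nat.RecursiveIn {oracle A} fun n => Part.some n.unpair.2 :=
    Nat.Primrec.recursiveIn (Primrec.nat_iff.1 (Primrec.snd.comp Primrec.unpair))
  have h1 := ((Nat.Primrec.recursiveIn (O := {oracle A}) (Primrec.nat_iff.1 hg)).comp
    (hid.pair (recursiveIn_initSeg.comp hsnd))).rfind
  have h2 := (Nat.Primrec.recursiveIn (O := {oracle A}) (Primrec.nat_iff.1 hH)).comp (hid.pair h1)
  refine h2.of_eq fun n => ?_
  have hF : ∀ m, ((Nat.pair <$> Part.some (Nat.pair n m) <*> (Part.some (Nat.pair n m).unpair.2 >>=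
      fun n => Part.some (Encodable.encode (initSeg A n)))) >>= fun n => Part.some (g n)) =
      Part.some (g (Nat.pair (Nat.pair n m) (Encodable.encode (initSeg A m)))) := by
    intro m
    simp [Seq.seq]
  have hFg : (Nat.rfind fun m => (fun m => decide (m = 0)) <$> ((Nat.pair <$>
      Part.some (Nat.pair n m) <*> (Part.some (Nat.pair n m).unpair.2 >>=
      fun n => Part.some (Encodable.encode (initSeg A n)))) >>= fun n => Part.some (g n))) =
      Nat.rfind fun m => Part.some
        (decide (g (Nat.pair (Nat.pair n m) (Encodable.encode (initSeg A m))) = 0)) := by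
    congr 1
    funext m
    rw [hF]
    simp
  change ((Nat.pair <$> Part.some n <*> (Nat.rfind fun m => (fun m => decide (m = 0)) <$>
      ((Nat.pair <$> Part.some (Nat.pair n m) <*> (Part.some (Nat.pair n m).unpair.2 >>=
      fun n => Part.some (Encodable.encode (initSeg A n)))) >>= fun n => Part.some (g n)))) >>=
      fun n => Part.some (H n)) = _
  rw [hFg]
  have hpair : ∀ P : Part ℕ, ((Nat.pair <$> Part.some n <*> P) >>= fun n => Part.some (H n)) =
      P.map fun m => H (Nat.pair n m) := by
    intro P
    simp only [Seq.seq, Part.map_eq_map, Part.map_some, Part.bind_eq_bind, Part.bind_some]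
    rw [Part.bind_some_eq_map, Part.map_map]
    rfl
  rcases hn : Encodable.decode (α := α) n with _ | a
  · have : ∀ m, g (Nat.pair (Nat.pair n m) (Encodable.encode (initSeg A m))) = 1 := by
      intro m
      simp [g, hn]
    simp only [this]
    have hnone : (Nat.rfind fun _ => Part.some (decide (1 = 0))) = Part.none := by
      refine Part.eq_none_iff.2 fun y hy => ?_
      have := (Nat.mem_rfind.1 hy).1
      simp at this
    rw [hnone, hpair]
    simp
  · have : ∀ m, g (Nat.pair (Nat.pair n m) (Encodable.encode (initSeg A m))) = 0 ↔
        R (initSeg A m) (m, a) := by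
      intro m
      simp [g, hn]
    simp only [this]
    rw [hpair]
    refine Eq.trans ?_ (Part.bind_some _ _).symm
    refine Eq.trans ?_ (Part.map_map _ _ _).symm
    congr 1
    funext m
    simp [H, hn]

/-- Forward by the use principle, backward by searching for a witnessing prefix. The closure
properties of `SigmaIn` then replace the writing of oracle programs. -/
theorem ceIn_iff_sigmaIn {S : Set α} : CEIn {oracle A} S ↔ SigmaIn A S := by
  constructor
  · rintro ⟨f, hf, rfl⟩
    convert (SigmaIn.graph_of_recursiveIn hf).exists using 1
    ext x
    simp [PFun.mem_dom]
  · rintro ⟨R, hR, rfl⟩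
    refine ⟨_, recursiveIn_search (R := fun σ p => R σ p.2) (h := fun _ _ => ())
      (hR.comp Primrec.fst (Primrec.snd.comp Primrec.snd)) (Primrec.const ()), ?_⟩
    ext x
    refine Iff.trans ?_ (PFun.mem_dom _ _).symm
    simp only [Part.mem_map_iff]
    classical
    constructor
    · rintro ⟨k, hk⟩
      have hd : (Nat.rfind fun m => Part.some (decide (R (initSeg A m) x))).Dom :=
        Nat.rfind_dom.2 ⟨k, by simpa using hk, fun _ => trivial⟩
      exact ⟨(), _, Part.get_mem hd, trivial⟩
    · rintro ⟨_, m, hm, -⟩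
      exact ⟨m, by simpa using (Nat.mem_rfind.1 hm).1⟩

theorem computableIn_of_graph {f : α → β} (hf : SigmaIn A {p : α × β | p.2 = f p.1}) :
    ComputableIn {oracle A} f := by
  obtain ⟨R, hR, hRm, hRS⟩ := hf.exists_monotone
  rcases isEmpty_or_nonempty α with hα | ⟨⟨a₀⟩⟩
  · exact (RecursiveIn.none (α := α) (σ := β)).of_eq fun x => (hα.false x).elim
  -- The search variable codes a pair (stage, value). It is at least its first component, so by
  -- monotonicity the prefix of that length suffices as a witness.
  obtain ⟨R', hR', hR'R⟩ : ∃ R' : Str → ℕ × α → Prop, PrimrecRel R' ∧ ∀ σ p, R' σ p ↔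
      ∃ y ∈ (Encodable.decode (α := β) p.1.unpair.2).toList, R σ (p.2, y) := by
    refine ⟨_, ?_, fun _ _ => Iff.rfl⟩
    have h1 : PrimrecRel fun (y : β) (p : Str × ℕ × α) => R p.1 (p.2.2, y) :=
      hR.comp (Primrec.fst.comp Primrec.snd)
        (Primrec.pair (Primrec.snd.comp (Primrec.snd.comp Primrec.snd)) Primrec.fst)
    exact h1.exists_mem_list.comp (Primrec.optionToList.comp (Primrec.decode.comp
      (Primrec.snd.comp (Primrec.unpair.comp (Primrec.fst.comp Primrec.snd))))) Primrec.id
  have hh : Primrec₂ fun (m : ℕ) (_ : α) =>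
      (Encodable.decode (α := β) m.unpair.2).getD (f a₀) :=
    Primrec.option_getD.comp (Primrec.decode.comp
      (Primrec.snd.comp (Primrec.unpair.comp Primrec.fst))) (Primrec.const _)
  refine (recursiveIn_search hR' hh).of_eq fun a => ?_
  refine Part.eq_some_iff.2 ?_
  rw [Part.mem_map_iff]
  have hdom : ∃ m, R' (initSeg A m) (m, a) := by
    obtain ⟨k, hk⟩ := (hRS (a, f a)).1 rfl
    refine ⟨Nat.pair k (Encodable.encode (f a)), (hR'R _ _).2 ⟨f a, by simp, ?_⟩⟩
    exact hRm _ _ _ (Nat.left_le_pair _ _) hk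
  classical
  have hd : (Nat.rfind fun m => Part.some (decide (R' (initSeg A m) (m, a)))).Dom :=
    Nat.rfind_dom.2 ⟨hdom.choose, by simpa using hdom.choose_spec, fun _ => trivial⟩
  obtain ⟨m, hm⟩ := Part.dom_iff_mem.1 hd
  refine ⟨m, hm, ?_⟩
  have hspec := (Nat.mem_rfind.1 hm).1
  obtain ⟨y, hy, hyR⟩ := (hR'R _ _).1 (by simpa using hspec)
  have hyf : y = f a := (hRS (a, y)).2 ⟨_, hyR⟩
  have hy : Encodable.decode m.unpair.2 = some y := Option.mem_toList.1 hy
  rw [hy, hyf, Option.getD_some]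

/-- `0`, as an oracle. -/
def zeroOracle : Cantor := fun _ => false

/-- Unrelativized notions become the case of a constant oracle, so that the lemmas on `SigmaIn`
cover them too. -/
theorem recursiveIn_empty_iff_zeroOracle {f : α →. β} :
    RecursiveIn ∅ f ↔ RecursiveIn {oracle zeroOracle} f := by
  refine ⟨RecursiveIn.mono (by simp), fun h => ?_⟩
  rw [recursiveIn_empty_iff]
  have h0 : oracle zeroOracle = fun _ => Part.some 0 := rfl
  rw [h0] at h
  exact h.partrec_of_const

theorem ceIn_empty_iff_sigmaIn {S : Set α} : CEIn ∅ S ↔ SigmaIn zeroOracle S := by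
  rw [← ceIn_iff_sigmaIn]
  simp only [CEIn, recursiveIn_empty_iff_zeroOracle]

end

/-! ### Concatenation -/

/-- The concatenation of a string and an infinite sequence. -/
def app (σ : Str) (Y : Cantor) : Cantor :=
  fun i => (σ[i]?).getD (Y (i - σ.length))

/-- `X` without its first `k` bits. -/
def shift (k : ℕ) (X : Cantor) : Cantor := fun i => X (k + i)

theorem shift_shift (k l : ℕ) (X : Cantor) : shift l (shift k X) = shift (k + l) X := by
  funext i
  simp [shift, add_assoc]

@[simp] theorem shift_zero (X : Cantor) : shift 0 X = X := by
  funext i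
  simp [shift]

theorem initSeg_app_length (σ : Str) (Y : Cantor) : initSeg (app σ Y) σ.length = σ := by
  refine List.ext_getElem (by simp) fun i h1 h2 => ?_
  simp [initSeg, app]

theorem initSeg_app_add (σ : Str) (Y : Cantor) (n : ℕ) :
    initSeg (app σ Y) (σ.length + n) = σ ++ initSeg Y n := by
  induction n with
  | zero => simpa [initSeg] using initSeg_app_length σ Y
  | succ n ih =>
    rw [← add_assoc, initSeg_succ, ih, initSeg_succ, List.append_assoc]
    simp [app]

theorem app_initSeg_shift (X : Cantor) (k : ℕ) : app (initSeg X k) (shift k X) = X := by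
  funext i
  rcases lt_or_ge i k with h | h
  · simp [app, getElem?_initSeg X h]
  · simp [app, h, shift]

theorem shift_app (σ : Str) (Y : Cantor) : shift σ.length (app σ Y) = Y := by
  funext i
  simp [app, shift]

theorem app_append (σ τ : Str) (Y : Cantor) : app (σ ++ τ) Y = app σ (app τ Y) := by
  funext i
  rcases lt_or_ge i σ.length with h | h
  · simp [app, h, List.getElem?_append_left]
  · simp [app, h, List.getElem?_append_right, Nat.sub_sub]

theorem initSeg_add (X : Cantor) (k n : ℕ) :
    initSeg X (k + n) = initSeg X k ++ initSeg (shift k X) n := by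
  conv_lhs => rw [← app_initSeg_shift X k]
  simpa using initSeg_app_add (initSeg X k) (shift k X) n

theorem mem_cyl {σ : Str} {X : Cantor} : X ∈ cyl σ ↔ initSeg X σ.length = σ := Iff.rfl

theorem app_mem_cyl (σ : Str) (Y : Cantor) : app σ Y ∈ cyl σ := initSeg_app_length σ Y

theorem mem_cyl_iff_prefix {σ : Str} {X : Cantor} :
    X ∈ cyl σ ↔ ∃ n, σ <+: initSeg X n :=
  ⟨fun h => ⟨σ.length, by rw [mem_cyl.1 h]⟩, fun ⟨_, h⟩ => (eq_initSeg_of_prefix h).symm⟩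

theorem mem_openOf {S : Set Str} {X : Cantor} : X ∈ openOf S ↔ ∃ n, initSeg X n ∈ S := by
  simp only [openOf, Set.mem_iUnion, mem_cyl, exists_prop]
  constructor
  · rintro ⟨σ, hσ, h⟩
    exact ⟨σ.length, by rwa [h]⟩
  · rintro ⟨n, hn⟩
    exact ⟨_, hn, by simp⟩

theorem cyl_subset_openOf {S : Set Str} {σ : Str} (h : σ ∈ S) : cyl σ ⊆ openOf S :=
  Set.subset_biUnion_of_mem (u := cyl) h

theorem cyl_anti {σ τ : Str} (h : σ <+: τ) : cyl τ ⊆ cyl σ := by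
  intro X hX
  exact mem_cyl_iff_prefix.2 ⟨τ.length, by rwa [mem_cyl.1 hX]⟩

theorem prefix_or_prefix_of_mem_cyl {σ τ : Str} {X : Cantor} (hσ : X ∈ cyl σ) (hτ : X ∈ cyl τ) :
    σ <+: τ ∨ τ <+: σ := by
  rw [← mem_cyl.1 hσ, ← mem_cyl.1 hτ]
  rcases le_total σ.length τ.length with h | h
  · exact Or.inl (initSeg_prefix X h)
  · exact Or.inr (initSeg_prefix X h)

theorem app_preimage_cyl_append (σ τ : Str) : app σ ⁻¹' cyl (σ ++ τ) = cyl τ := by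
  ext Y
  rw [Set.mem_preimage, mem_cyl, mem_cyl, List.length_append, initSeg_app_add]
  simp

theorem app_preimage_cyl_of_prefix {σ τ : Str} (h : τ <+: σ) : app σ ⁻¹' cyl τ = Set.univ :=
  Set.eq_univ_of_forall fun Y => cyl_anti h (app_mem_cyl σ Y)

/-! ### The uniform measure -/

instance : IsProbabilityMeasure lam := by
  unfold lam; infer_instance

theorem measurable_app (σ : Str) : Measurable (app σ) := by
  refine measurable_pi_lambda _ fun i => ?_
  unfold app
  cases σ[i]? with
  | none => exact measurable_pi_apply _
  | some b => exact measurable_const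

theorem cyl_eq_pi (σ : Str) :
    cyl σ = Set.pi (Finset.range σ.length) fun i => {(σ[i]?).getD false} := by
  ext X
  simp only [mem_cyl, Set.mem_pi, Finset.coe_range, Set.mem_Iio, Set.mem_singleton_iff]
  constructor
  · intro h i hi
    have := getElem?_initSeg X hi
    rw [h] at this
    simp [this]
  · intro h
    refine List.ext_getElem (by simp) fun i h1 h2 => ?_
    have := h i h2
    simp [initSeg, this, h2]

theorem measurableSet_cyl (σ : Str) : MeasurableSet (cyl σ) := by
  rw [cyl_eq_pi]
  exact MeasurableSet.pi (Set.to_countable _) fun _ _ => trivial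

theorem measurableSet_openOf (S : Set Str) : MeasurableSet (openOf S) :=
  MeasurableSet.biUnion (Set.to_countable S) fun σ _ => measurableSet_cyl σ

theorem lam_cyl (σ : Str) : lam (cyl σ) = (2⁻¹ : ℝ≥0∞) ^ σ.length := by
  rw [cyl_eq_pi, lam, Measure.infinitePi_pi]
  · simp
  · intro i _
    trivial

theorem generateFrom_cyl :
    (MeasurableSpace.pi : MeasurableSpace Cantor) =
      MeasurableSpace.generateFrom {B | B = ∅ ∨ ∃ σ, B = cyl σ} := by
  refine le_antisymm ?_ ?_
  · refine iSup_le fun i => ?_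
    rw [← measurable_iff_comap_le]
    refine @measurable_to_bool _ (_) _ ?_
    have : (fun X : Cantor => X i) ⁻¹' {true} =
        ⋃ σ ∈ {σ : Str | σ.length = i + 1 ∧ σ[i]? = some true}, cyl σ := by
      ext X
      simp only [Set.mem_preimage, Set.mem_singleton_iff, Set.mem_iUnion, exists_prop]
      constructor
      · intro h
        exact ⟨initSeg X (i + 1), ⟨by simp, by rw [getElem?_initSeg X (Nat.lt_succ_self i), h]⟩,
          by simp [mem_cyl]⟩
      · rintro ⟨σ, ⟨h1, h2⟩, h3⟩
        rw [← mem_cyl.1 h3, h1, getElem?_initSeg X (Nat.lt_succ_self i)] at h2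
        simpa using h2
    rw [this]
    exact @MeasurableSet.biUnion _ _ (_) _ _ (Set.to_countable _) fun σ _ =>
      MeasurableSpace.measurableSet_generateFrom (Or.inr ⟨σ, rfl⟩)
  · refine MeasurableSpace.generateFrom_le ?_
    rintro B (rfl | ⟨σ, rfl⟩)
    · exact MeasurableSet.empty
    · exact measurableSet_cyl σ

theorem isPiSystem_cyl : IsPiSystem {B | B = ∅ ∨ ∃ σ, B = cyl σ} := by
  rintro B hB C hC ⟨X, hXB, hXC⟩
  rcases hB with rfl | ⟨σ, rfl⟩
  · exact hXB.elim
  rcases hC with rfl | ⟨τ, rfl⟩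
  · exact hXC.elim
  rcases prefix_or_prefix_of_mem_cyl hXB hXC with h | h
  · exact Or.inr ⟨τ, Set.inter_eq_right.2 (cyl_anti h)⟩
  · exact Or.inr ⟨σ, Set.inter_eq_left.2 (cyl_anti h)⟩

/-- Self-similarity of coin tossing. The two measures agree on cylinders, since two cylinders are
nested or disjoint, and cylinders form a generating π-system. -/
theorem restrict_cyl (σ : Str) :
    lam.restrict (cyl σ) = ((2⁻¹ : ℝ≥0∞) ^ σ.length) • lam.map (app σ) := by
  have hfin : IsFiniteMeasure (((2⁻¹ : ℝ≥0∞) ^ σ.length) • lam.map (app σ)) := by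
    have := Measure.isProbabilityMeasure_map (μ := lam) (measurable_app σ).aemeasurable
    exact Measure.smul_finite _ (by simp)
  refine ext_of_generate_finite _ generateFrom_cyl isPiSystem_cyl ?_ ?_
  · rintro B (rfl | ⟨τ, rfl⟩)
    · simp
    rw [Measure.restrict_apply (measurableSet_cyl τ), Measure.smul_apply,
      Measure.map_apply (measurable_app σ) (measurableSet_cyl τ), smul_eq_mul]
    by_cases h : ∃ X, X ∈ cyl σ ∧ X ∈ cyl τ
    · obtain ⟨X, h1, h2⟩ := h
      rcases prefix_or_prefix_of_mem_cyl h1 h2 with h | h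
      · rw [Set.inter_eq_left.2 (cyl_anti h)]
        obtain ⟨ρ, rfl⟩ := h
        rw [app_preimage_cyl_append, lam_cyl, lam_cyl, List.length_append, pow_add]
      · rw [Set.inter_eq_right.2 (cyl_anti h), app_preimage_cyl_of_prefix h, lam_cyl]
        simp
    · have h1 : cyl τ ∩ cyl σ = ∅ := by
        ext X
        simp only [Set.mem_inter_iff, Set.mem_empty_iff_false, iff_false]
        exact fun hX => h ⟨X, hX.2, hX.1⟩
      have h2 : app σ ⁻¹' cyl τ = ∅ := by
        ext Y
        simp only [Set.mem_preimage, Set.mem_empty_iff_false, iff_false]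
        exact fun hY => h ⟨_, app_mem_cyl σ Y, hY⟩
      rw [h1, h2]
      simp
  · rw [Measure.restrict_apply MeasurableSet.univ, Measure.smul_apply,
      Measure.map_apply (measurable_app σ) MeasurableSet.univ, Set.univ_inter, lam_cyl]
    simp

theorem lam_inter_cyl {B : Set Cantor} (hB : MeasurableSet B) (σ : Str) :
    lam (B ∩ cyl σ) = (2⁻¹ : ℝ≥0∞) ^ σ.length * lam (app σ ⁻¹' B) := by
  rw [← Measure.restrict_apply hB, restrict_cyl, Measure.smul_apply,
    Measure.map_apply (measurable_app σ) hB, smul_eq_mul]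

/-- Thus `lam (app σ ⁻¹' B)` is the conditional probability of `B` given `σ`, and it is used in this
sense from here on. -/
theorem lam_app_preimage {B : Set Cantor} (hB : MeasurableSet B) (σ : Str) :
    lam (app σ ⁻¹' B) = 2 ^ σ.length * lam (B ∩ cyl σ) := by
  rw [lam_inter_cyl hB, ← mul_assoc, ← mul_pow, ENNReal.mul_inv_cancel (by simp) (by simp)]
  simp

theorem lam_app_preimage_le {B : Set Cantor} (hB : MeasurableSet B) (σ : Str) :
    lam (app σ ⁻¹' B) ≤ 2 ^ σ.length * lam B := by
  rw [lam_app_preimage hB]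
  gcongr
  exact Set.inter_subset_left

/-! ### Prefix-free sets and iterated concatenation -/

/-- No element of `S` is a proper prefix of another. -/
def PrefixFree (S : Set Str) : Prop := ∀ σ ∈ S, ∀ τ ∈ S, σ <+: τ → σ = τ

/-- The elements of `S` without proper prefixes in `S`. -/
def minimals (S : Set Str) : Set Str := {σ | σ ∈ S ∧ ∀ τ, τ <+: σ → τ ∈ S → τ = σ}

theorem prefixFree_minimals (S : Set Str) : PrefixFree (minimals S) :=
  fun σ hσ _ hτ h => hτ.2 σ h hσ.1

theorem exists_prefix_mem_minimals {S : Set Str} {σ : Str} (h : σ ∈ S) :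
    ∃ τ ∈ minimals S, τ <+: σ := by
  induction hn : σ.length using Nat.strong_induction_on generalizing σ with
  | _ n ih =>
    by_cases hm : σ ∈ minimals S
    · exact ⟨σ, hm, List.prefix_rfl⟩
    · have : ∃ τ, τ <+: σ ∧ τ ∈ S ∧ τ ≠ σ := by
        by_contra! hc
        exact hm ⟨h, hc⟩
      obtain ⟨τ, h1, h2, h3⟩ := this
      have hl : τ.length < n := by
        rw [← hn]
        refine lt_of_le_of_ne h1.length_le fun he => h3 (h1.eq_of_length he)
      obtain ⟨ρ, hρ, hρτ⟩ := ih _ hl h2 rfl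
      exact ⟨ρ, hρ, hρτ.trans h1⟩

theorem openOf_mono {S T : Set Str} (h : S ⊆ T) : openOf S ⊆ openOf T :=
  Set.biUnion_mono h fun _ _ => subset_rfl

theorem openOf_minimals (S : Set Str) : openOf (minimals S) = openOf S := by
  refine Set.Subset.antisymm (openOf_mono fun σ h => h.1) ?_
  refine Set.iUnion₂_subset fun σ hσ => ?_
  obtain ⟨τ, hτ, h⟩ := exists_prefix_mem_minimals hσ
  exact (cyl_anti h).trans (cyl_subset_openOf hτ)

theorem PrefixFree.pairwiseDisjoint {S : Set Str} (hS : PrefixFree S) :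
    S.PairwiseDisjoint cyl := by
  intro σ hσ τ hτ hne
  refine Set.disjoint_left.2 fun X h1 h2 => hne ?_
  rcases prefix_or_prefix_of_mem_cyl h1 h2 with h | h
  · exact hS _ hσ _ hτ h
  · exact (hS _ hτ _ hσ h).symm

theorem PrefixFree.lam_openOf {S : Set Str} (hS : PrefixFree S) :
    lam (openOf S) = ∑' σ : S, (2⁻¹ : ℝ≥0∞) ^ (σ : Str).length := by
  rw [openOf, measure_biUnion (Set.to_countable S) hS.pairwiseDisjoint
    fun σ _ => measurableSet_cyl σ]
  simp only [lam_cyl]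

/-- The sequences consisting of an element of `S` followed by an element of `B`. -/
def conc (S : Set Str) (B : Set Cantor) : Set Cantor :=
  ⋃ σ ∈ S, shift σ.length ⁻¹' B ∩ cyl σ

theorem conc_mono {S : Set Str} {B C : Set Cantor} (h : B ⊆ C) : conc S B ⊆ conc S C :=
  Set.biUnion_mono subset_rfl fun _ _ => Set.inter_subset_inter_left _ (Set.preimage_mono h)

theorem measurable_shift (k : ℕ) : Measurable (shift k) :=
  measurable_pi_lambda _ fun _ => measurable_pi_apply _

theorem PrefixFree.lam_conc {S : Set Str} (hS : PrefixFree S) {B : Set Cantor}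
    (hB : MeasurableSet B) : lam (conc S B) = lam (openOf S) * lam B := by
  rw [conc, measure_biUnion (Set.to_countable S), hS.lam_openOf, ← ENNReal.tsum_mul_right]
  · refine tsum_congr fun σ => ?_
    rw [lam_inter_cyl (measurable_shift _ hB), ← Set.preimage_comp]
    have : shift (σ : Str).length ∘ app (σ : Str) = id := funext fun Y => shift_app _ Y
    rw [this, Set.preimage_id]
  · exact hS.pairwiseDisjoint.mono fun σ => Set.inter_subset_right
  · exact fun σ _ => (measurable_shift _ hB).inter (measurableSet_cyl σ)

/-- The sequences starting with `n` consecutive elements of `S`. -/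
def iter (S : Set Str) : ℕ → Set Cantor
  | 0 => Set.univ
  | n + 1 => conc S (iter S n)

theorem iter_antitone (S : Set Str) : Antitone (iter S) := by
  refine antitone_nat_of_succ_le fun n => ?_
  induction n with
  | zero => exact Set.subset_univ _
  | succ n ih => exact conc_mono ih

theorem mem_iter_succ {S : Set Str} {n : ℕ} {X : Cantor} :
    X ∈ iter S (n + 1) ↔ ∃ m, initSeg X m ∈ S ∧ shift m X ∈ iter S n := by
  simp only [iter, conc, Set.mem_iUnion, Set.mem_inter_iff, Set.mem_preimage, exists_prop]
  constructor
  · rintro ⟨σ, hσ, h, hX⟩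
    exact ⟨σ.length, by rwa [mem_cyl.1 hX], h⟩
  · rintro ⟨m, hm, h⟩
    exact ⟨_, hm, by simpa using h, by simp [mem_cyl]⟩

theorem mem_iter_iff {S : Set Str} {n : ℕ} {X : Cantor} :
    X ∈ iter S n ↔ ∃ l : List Str, l.length = n ∧ (∀ σ ∈ l, σ ∈ S) ∧
      initSeg X l.flatten.length = l.flatten := by
  induction n generalizing X with
  | zero =>
    simp only [iter, Set.mem_univ, true_iff]
    exact ⟨[], rfl, by simp, by simp [initSeg]⟩
  | succ n ih =>
    rw [mem_iter_succ]
    constructor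
    · rintro ⟨m, hm, h⟩
      obtain ⟨l, hl, hS, hX⟩ := ih.1 h
      refine ⟨initSeg X m :: l, by simp [hl], ?_, ?_⟩
      · intro σ hσ
        rcases List.mem_cons.1 hσ with rfl | hσ
        · exact hm
        · exact hS σ hσ
      · rw [List.flatten_cons, List.length_append, length_initSeg, initSeg_add, hX]
    · rintro ⟨l, hl, hS, hX⟩
      obtain ⟨σ, l, rfl⟩ := List.exists_cons_of_length_eq_add_one hl
      rw [List.flatten_cons, List.length_append, initSeg_add] at hX
      obtain ⟨h1, h2⟩ := List.append_inj hX (by simp)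
      refine ⟨σ.length, by rw [h1]; exact hS _ List.mem_cons_self, ?_⟩
      exact ih.2 ⟨l, by simpa using hl, fun τ hτ => hS τ (List.mem_cons_of_mem _ hτ), h2⟩

theorem iter_eq_openOf (S : Set Str) (n : ℕ) :
    iter S n = openOf {σ | ∃ l : List Str, l.length = n ∧ (∀ τ ∈ l, τ ∈ S) ∧ σ = l.flatten} := by
  ext X
  rw [mem_iter_iff, mem_openOf]
  constructor
  · rintro ⟨l, h1, h2, h3⟩
    exact ⟨_, l, h1, h2, h3⟩
  · rintro ⟨m, l, h1, h2, h3⟩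
    refine ⟨l, h1, h2, ?_⟩
    rw [← h3, length_initSeg]

theorem measurableSet_iter (S : Set Str) (n : ℕ) : MeasurableSet (iter S n) := by
  rw [iter_eq_openOf]
  exact measurableSet_openOf _

theorem PrefixFree.lam_iter {S : Set Str} (hS : PrefixFree S) (n : ℕ) :
    lam (iter S n) = lam (openOf S) ^ n := by
  induction n with
  | zero => simp [iter]
  | succ n ih => rw [iter, hS.lam_conc (measurableSet_iter S n), ih, pow_succ']

/-! ### Effectively open sets -/

/-- `U` is c.e. open in the oracle `A`. -/
def CEOpen (A : Cantor) (U : Set Cantor) : Prop := ∃ S, SigmaIn A S ∧ U = openOf S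

theorem CEOpen.measurableSet {A : Cantor} {U : Set Cantor} (h : CEOpen A U) :
    MeasurableSet U := by
  obtain ⟨S, -, rfl⟩ := h
  exact measurableSet_openOf S

theorem CEOpen.union {A : Cantor} {U V : Set Cantor} (hU : CEOpen A U) (hV : CEOpen A V) :
    CEOpen A (U ∪ V) := by
  obtain ⟨S, hS, rfl⟩ := hU
  obtain ⟨T, hT, rfl⟩ := hV
  refine ⟨_, hS.union hT, ?_⟩
  ext X
  simp only [Set.mem_union, mem_openOf, Set.mem_ofPred_eq, exists_or]

theorem primrecRel_isPrefix : PrimrecRel fun σ τ : Str => σ <+: τ := by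
  have : PrimrecRel fun σ τ : Str => σ = τ.take σ.length :=
    Primrec.eq.comp Primrec.fst (Primrec.list_take.comp
      (Primrec.list_length.comp Primrec.fst) Primrec.snd)
  exact this.of_eq fun σ τ => List.prefix_iff_eq_take.symm

/-- The strings with a prefix in the `n`-th member of a family. -/
def upClosure {α : Type} (S : Set (α × Str)) : Set (α × Str) :=
  {p | ∃ τ, τ <+: p.2 ∧ (p.1, τ) ∈ S}

theorem SigmaIn.upClosure {α : Type} [Primcodable α] {A : Cantor} {S : Set (α × Str)}
    (hS : SigmaIn A S) : SigmaIn A (upClosure S) := by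
  have h1 : SigmaIn A {p : (α × Str) × Str | p.2 <+: p.1.2} :=
    SigmaIn.of_primrecPred (primrecRel_isPrefix.comp Primrec.snd (Primrec.snd.comp Primrec.fst))
  have h2 : SigmaIn A {p : (α × Str) × Str | (p.1.1, p.2) ∈ S} :=
    hS.preimage (Primrec.pair (Primrec.fst.comp Primrec.fst) Primrec.snd)
  exact (h1.inter h2).exists

theorem upClosure_append {α : Type} {S : Set (α × Str)} {a : α} {σ : Str}
    (h : (a, σ) ∈ upClosure S) {τ : Str} (hτ : σ <+: τ) : (a, τ) ∈ upClosure S := by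
  obtain ⟨ρ, h1, h2⟩ := h
  exact ⟨ρ, h1.trans hτ, h2⟩

/-- The offset `k` serves `X = app σ Y` with `k = σ.length`, where the prefixes considered are `σ`
followed by prefixes of `Y`. -/
theorem mem_openOf_iff_upClosure {α : Type} {S : Set (α × Str)} {a : α} {X : Cantor} (k : ℕ) :
    X ∈ openOf {σ | (a, σ) ∈ S} ↔ ∃ n, (a, initSeg X (k + n)) ∈ upClosure S := by
  rw [mem_openOf]
  constructor
  · rintro ⟨n, hn⟩
    exact ⟨n, _, initSeg_prefix X (Nat.le_add_left n k), hn⟩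
  · rintro ⟨n, τ, h1, h2⟩
    refine ⟨τ.length, ?_⟩
    rw [← eq_initSeg_of_prefix h1]
    exact h2

theorem CEOpen.app_preimage {A : Cantor} {U : Set Cantor} (hU : CEOpen A U) (σ : Str) :
    CEOpen A (app σ ⁻¹' U) := by
  obtain ⟨S, hS, rfl⟩ := hU
  have hS' : SigmaIn A {p : Unit × Str | p.2 ∈ S} := hS.preimage Primrec.snd
  refine ⟨_, hS'.upClosure.preimage (f := fun τ : Str => ((), σ ++ τ))
    (Primrec.pair (Primrec.const _) (Primrec.list_append.comp (Primrec.const σ) Primrec.id)), ?_⟩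
  ext Y
  have := mem_openOf_iff_upClosure (S := {p : Unit × Str | p.2 ∈ S}) (a := ()) (X := app σ Y)
    σ.length
  rw [Set.mem_preimage, mem_openOf (S := {x | _})]
  simp only [initSeg_app_add] at this
  exact this

/-- Every c.e. open set is generated by a prefix-free c.e. set. -/
theorem CEOpen.exists_prefixFree {A : Cantor} {U : Set Cantor} (hU : CEOpen A U) :
    ∃ S, SigmaIn A S ∧ PrefixFree S ∧ U = openOf S := by
  obtain ⟨S, hS, rfl⟩ := hU
  obtain ⟨R, hR, hRm, hRS⟩ := hS.exists_monotone
  -- Enumeration is delayed: `τ` enters once some prefix of it has appeared by stage `τ.length`.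
  -- Membership in `E`, and hence minimality in `E`, is then decided by the prefix of `A` of length
  -- `τ.length`.
  let E : Set Str := {τ | ∃ k ≤ τ.length, R (initSeg A τ.length) (τ.take k)}
  have hE : openOf E = openOf S := by
    ext X
    rw [mem_openOf, mem_openOf]
    constructor
    · rintro ⟨n, k, hk, h⟩
      rw [length_initSeg] at hk
      rw [take_initSeg X hk] at h
      exact ⟨k, (hRS _).2 ⟨_, h⟩⟩
    · rintro ⟨n, hn⟩
      obtain ⟨k, hk⟩ := (hRS _).1 hn
      refine ⟨max n k, n, by simp, ?_⟩
      rw [take_initSeg X (le_max_left _ _)]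
      exact hRm _ _ _ (by simp) hk
  refine ⟨minimals E, ?_, prefixFree_minimals E, by rw [openOf_minimals, hE]⟩
  let Q : Str → Str → Prop := fun σ τ => ∃ k ∈ List.range (τ.length + 1),
    R (σ.take τ.length) (τ.take k)
  have hQ : PrimrecRel Q := by
    have : PrimrecRel fun (k : ℕ) (p : Str × Str) => R (p.1.take p.2.length) (p.2.take k) :=
      hR.comp (Primrec.list_take.comp (Primrec.list_length.comp (Primrec.snd.comp Primrec.snd))
        (Primrec.fst.comp Primrec.snd)) (Primrec.list_take.comp Primrec.fst
          (Primrec.snd.comp Primrec.snd))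
    exact this.exists_mem_list.comp (Primrec.list_range.comp (Primrec.succ.comp
      (Primrec.list_length.comp Primrec.snd))) Primrec.id
  have hQE : ∀ n τ, τ.length ≤ n → (Q (initSeg A n) τ ↔ τ ∈ E) := by
    intro n τ h
    simp only [Q, E, List.mem_range, Nat.lt_succ_iff, take_initSeg A h, Set.mem_ofPred_eq]
  let P : Str → Str → Prop := fun σ τ => Q σ τ ∧
    ∀ k ∈ List.range τ.length, ¬ Q σ (τ.take k)
  have hP : PrimrecRel P := by
    refine PrimrecPred.and hQ ?_
    have : PrimrecRel fun (k : ℕ) (p : Str × Str) => ¬ Q p.1 (p.2.take k) :=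
      PrimrecPred.not (hQ.comp (Primrec.fst.comp Primrec.snd) (Primrec.list_take.comp Primrec.fst
        (Primrec.snd.comp Primrec.snd)))
    exact this.forall_mem_list.comp (Primrec.list_range.comp 
      (Primrec.list_length.comp Primrec.snd)) Primrec.id
  convert SigmaIn.of_primrecRel_initSeg (A := A) hP Primrec.list_length using 1
  ext τ
  simp only [minimals, Set.mem_ofPred_eq, P, List.mem_range]
  refine and_congr (hQE _ _ le_rfl).symm ?_
  constructor
  · intro h k hk hq
    have := h (τ.take k) (List.take_prefix _ _) ((hQE _ _ (by simp)).1 hq)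
    have := congrArg List.length this
    simp at this
    omega
  · intro h ρ hρ hρE
    by_contra hne
    have hl : ρ.length < τ.length := lt_of_le_of_ne hρ.length_le fun he => hne (hρ.eq_of_length he)
    refine h ρ.length hl ?_
    rw [← List.prefix_iff_eq_take.1 hρ]
    exact (hQE _ _ hl.le).2 hρE

/-! ### Tests from iterated concatenation -/

theorem uniformlyCEOpenIn_iter {O : Set (ℕ →. ℕ)} {A : Cantor}
    (hO : ∀ T : Set (ℕ × Str), CEIn O T ↔ SigmaIn A T) {S : Set Str} (hS : SigmaIn A S) (c : ℕ) :
    UniformlyCEOpenIn O fun n => iter S (c * n) := by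
  refine ⟨fun n => {σ | ∃ l : List Str, l.length = c * n ∧ (∀ τ ∈ l, τ ∈ S) ∧ σ = l.flatten},
    (hO _).2 ?_, fun n => iter_eq_openOf S _⟩
  have h1 : SigmaIn A {p : (ℕ × Str) × List Str | p.2.length = c * p.1.1} :=
    SigmaIn.of_primrecPred (Primrec.eq.comp (Primrec.list_length.comp Primrec.snd)
      (Primrec.nat_mul.comp (Primrec.const c) (Primrec.fst.comp Primrec.fst)))
  have h2 : SigmaIn A {p : (ℕ × Str) × List Str | p.1.2 = p.2.flatten} :=
    SigmaIn.of_primrecPred (Primrec.eq.comp (Primrec.snd.comp Primrec.fst)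
      (Primrec.list_flatten.comp Primrec.snd))
  have h3 : SigmaIn A {p : (ℕ × Str) × List Str | ∀ τ ∈ p.2, τ ∈ S} :=
    (SigmaIn.forall_mem_list (β := Unit) (hS.preimage Primrec.fst)).preimage
      (f := fun p : (ℕ × Str) × List Str => (p.2, ())) (Primrec.pair Primrec.snd (Primrec.const ()))
  exact (h1.inter (h3.inter h2)).exists

/-- Taking `c` blocks at a time makes each step at least halve the measure. The hypothesis `hO` lets
one proof serve both `∅` and `{oracle A}`. -/
theorem isMLTest_iter {O : Set (ℕ →. ℕ)} {A : Cantor}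
    (hO : ∀ T : Set (ℕ × Str), CEIn O T ↔ SigmaIn A T) {S : Set Str} (hS : SigmaIn A S)
    (hpf : PrefixFree S) {c : ℕ} (hc : lam (openOf S) ^ c ≤ 2⁻¹) :
    IsMLTest O fun n => iter S (c * n) where
  antitone := fun _ _ h => iter_antitone S (Nat.mul_le_mul_left c h)
  ce := uniformlyCEOpenIn_iter hO hS c
  measure_le n := by
    rw [hpf.lam_iter, pow_mul]
    gcongr

theorem isSchnorrTest_iter {A : Cantor} {S : Set Str} (hS : SigmaIn A S)
    (hpf : PrefixFree S) (h : lam (openOf S) = 2⁻¹) :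
    IsSchnorrTest {oracle A} (iter S) where
  toIsMLTest := by
    simpa using isMLTest_iter (fun _ => ceIn_iff_sigmaIn) hS hpf (c := 1) (by simp [h])
  measure_eq n := by rw [hpf.lam_iter, h]

/-! ### Approximating the measure of c.e. open sets -/

theorem primrec_two_pow : Primrec fun n : ℕ => 2 ^ n := by
  have : Primrec fun n : ℕ => (n.rec 1 fun _ m => 2 * m : ℕ) :=
    Primrec.nat_rec₁ 1 (Primrec.nat_mul.comp (Primrec.const 2) Primrec.snd)
  refine this.of_eq fun n => ?_
  induction n with
  | zero => rfl
  | succ n ih => rw [pow_succ', ← ih]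

theorem primrecPred_nodup {α : Type} [Primcodable α] : PrimrecPred fun l : List α => l.Nodup := by
  have h0 : PrimrecRel fun (i : ℕ) (p : ℕ × List α) => ¬ p.2[i]? = p.2[p.1]? :=
    PrimrecPred.not (Primrec.eq.comp
      (Primrec.list_getElem?.comp (Primrec.snd.comp Primrec.snd) Primrec.fst)
      (Primrec.list_getElem?.comp (Primrec.snd.comp Primrec.snd) (Primrec.fst.comp Primrec.snd)))
  have h1 : PrimrecRel fun (j : ℕ) (l : List α) => ∀ i ∈ List.range j, ¬ l[i]? = l[j]? :=
    h0.forall_mem_list.comp (Primrec.list_range.comp Primrec.fst)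
      (Primrec.pair Primrec.fst Primrec.snd)
  have h2 := h1.forall_mem_list.comp (Primrec.list_range.comp Primrec.list_length) Primrec.id
  refine h2.of_eq fun l => ?_
  rw [List.nodup_iff_getElem?_ne_getElem?]
  simp only [List.mem_range, id]
  exact ⟨fun h i j hij hj => h j hj i hij, fun h j hj i hij => h i j hij hj⟩

/-- The strings of length `s`. -/
def strs (s : ℕ) : Finset Str := Finset.univ.image (List.ofFn : (Fin s → Bool) → Str)

@[simp] theorem mem_strs {s : ℕ} {σ : Str} : σ ∈ strs s ↔ σ.length = s := by
  simp only [strs, Finset.mem_image, Finset.mem_univ, true_and]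
  constructor
  · rintro ⟨f, rfl⟩
    simp
  · rintro rfl
    exact ⟨σ.get, List.ofFn_get σ⟩

theorem lam_openOf_finset {F : Finset Str} {s : ℕ} (h : ∀ σ ∈ F, σ.length = s) :
    lam (openOf ↑F) = F.card * (2⁻¹ : ℝ≥0∞) ^ s := by
  have hpf : PrefixFree (F : Set Str) := fun σ hσ τ hτ hp =>
    hp.eq_of_length (by rw [h σ hσ, h τ hτ])
  have h2 : ∀ σ : (F : Set Str), (2⁻¹ : ℝ≥0∞) ^ (σ : Str).length = 2⁻¹ ^ s :=
    fun σ => by rw [h _ σ.2]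
  rw [hpf.lam_openOf]
  simp only [h2]
  rw [tsum_fintype]
  simp

theorem mem_openOf_finset {F : Finset Str} {s : ℕ} (h : ∀ σ ∈ F, σ.length = s) {X : Cantor} :
    X ∈ openOf ↑F ↔ initSeg X s ∈ F := by
  rw [mem_openOf]
  constructor
  · rintro ⟨n, hn⟩
    have := h _ hn
    rw [length_initSeg] at this
    exact this ▸ hn
  · exact fun hs => ⟨s, hs⟩

open Classical in
/-- The strings of length `s` known to generate part of the `a`-th member of a family. -/
def stage {α : Type} (S : Set (α × Str)) (a : α) (s : ℕ) : Finset Str :=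
  (strs s).filter fun σ => (a, σ) ∈ upClosure S

section
variable {α : Type} {S : Set (α × Str)} {a : α}

theorem mem_stage {s : ℕ} {σ : Str} :
    σ ∈ stage S a s ↔ σ.length = s ∧ (a, σ) ∈ upClosure S := by
  simp [stage]

theorem openOf_subset_of_mem_upClosure {T : Set Str} (h : ∀ σ ∈ T, (a, σ) ∈ upClosure S) :
    openOf T ⊆ openOf {σ | (a, σ) ∈ S} := by
  intro X hX
  obtain ⟨n, hn⟩ := mem_openOf.1 hX
  exact (mem_openOf_iff_upClosure 0).2 ⟨n, by simpa using h _ hn⟩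

theorem lam_stage (s : ℕ) :
    lam (openOf ↑(stage S a s)) = (stage S a s).card * (2⁻¹ : ℝ≥0∞) ^ s :=
  lam_openOf_finset fun _ hσ => (mem_stage.1 hσ).1

theorem tendsto_card_stage : Tendsto (fun s => (stage S a s).card * (2⁻¹ : ℝ≥0∞) ^ s) atTop
    (nhds (lam (openOf {σ | (a, σ) ∈ S}))) := by
  have hmem : ∀ s X, X ∈ openOf ↑(stage S a s) ↔ (a, initSeg X s) ∈ upClosure S := by
    intro s X
    rw [mem_openOf_finset (s := s) fun _ hσ => (mem_stage.1 hσ).1, mem_stage]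
    simp
  have hU : openOf {σ | (a, σ) ∈ S} = ⋃ s, openOf ↑(stage S a s) := by
    ext X
    rw [mem_openOf_iff_upClosure 0, Set.mem_iUnion]
    simp only [hmem, zero_add]
  have hmono : Monotone fun s => openOf (stage S a s : Set Str) := by
    intro s t hst X hX
    rw [hmem] at hX ⊢
    exact upClosure_append hX (initSeg_prefix X hst)
  have := tendsto_measure_iUnion_atTop (μ := lam) hmono
  rw [← hU] at this
  simpa only [Function.comp_def, lam_stage] using this

/-- The inequality is witnessed by finitely many strings of a common length. Since the threshold is
dyadic, the comparison can be made between natural numbers. -/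
theorem SigmaIn.lam_gt [Primcodable α] {A : Cantor} (hS : SigmaIn A S) (p : ℕ) :
    SigmaIn A {a | 1 - (2⁻¹ : ℝ≥0∞) ^ p < lam (openOf {σ | (a, σ) ∈ S})} := by
  have hnum : ∀ n s : ℕ, 1 - (2⁻¹ : ℝ≥0∞) ^ p < n * 2⁻¹ ^ s ↔ 2 ^ p * 2 ^ s < n * 2 ^ p + 2 ^ s := by
    intro n s
    have e : ∀ k : ℕ, (2⁻¹ : ℝ≥0∞) ^ k * 2 ^ k = 1 := fun k => by
      rw [← mul_pow, ENNReal.inv_mul_cancel (by simp) (by simp), one_pow]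
    have h1 : (n * (2⁻¹ : ℝ≥0∞) ^ s + 2⁻¹ ^ p) * (2 ^ p * 2 ^ s) = n * 2 ^ p + 2 ^ s := by
      calc _ = n * 2 ^ p * ((2⁻¹ : ℝ≥0∞) ^ s * 2 ^ s) + 2 ^ s * (2⁻¹ ^ p * 2 ^ p) := by ring
        _ = _ := by rw [e, e, mul_one, mul_one]
    rw [ENNReal.sub_lt_iff_lt_right (by simp) (pow_le_one₀ (by simp) (by simp)),
      ← ENNReal.mul_lt_mul_iff_left (c := 2 ^ p * 2 ^ s) (by simp) (by finiteness), h1, one_mul]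
    exact_mod_cast Iff.rfl
  have h1 : SigmaIn A {q : α × ℕ × List Str | q.2.2.Nodup ∧
      2 ^ p * 2 ^ q.2.1 < q.2.2.length * 2 ^ p + 2 ^ q.2.1} := by
    refine SigmaIn.of_primrecPred (PrimrecPred.and
      (primrecPred_nodup.comp (Primrec.snd.comp Primrec.snd)) ?_)
    have hs : Primrec fun q : α × ℕ × List Str => 2 ^ q.2.1 :=
      primrec_two_pow.comp (Primrec.fst.comp Primrec.snd)
    exact Primrec.nat_lt.comp (Primrec.nat_mul.comp (Primrec.const _) hs)
      (Primrec.nat_add.comp (Primrec.nat_mul.comp (Primrec.list_length.comp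
        (Primrec.snd.comp Primrec.snd)) (Primrec.const _)) hs)
  have h2 : SigmaIn A {q : Str × α × ℕ | q.1.length = q.2.2 ∧ (q.2.1, q.1) ∈ Randomness.upClosure S} := by
    refine SigmaIn.inter (S := {q : Str × α × ℕ | q.1.length = q.2.2}) ?_
      (hS.upClosure.preimage (Primrec.pair (Primrec.fst.comp Primrec.snd) Primrec.fst))
    exact SigmaIn.of_primrecPred (Primrec.eq.comp (Primrec.list_length.comp Primrec.fst)
      (Primrec.snd.comp Primrec.snd))
  have h3 : SigmaIn A {q : α × ℕ × List Str | ∀ σ ∈ q.2.2, σ.length = q.2.1 ∧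
      (q.1, σ) ∈ Randomness.upClosure S} :=
    h2.forall_mem_list.preimage (f := fun q : α × ℕ × List Str => (q.2.2, (q.1, q.2.1)))
      (Primrec.pair (Primrec.snd.comp Primrec.snd) (Primrec.pair Primrec.fst
        (Primrec.fst.comp Primrec.snd)))
  convert (h1.inter h3).exists using 1
  ext a
  simp only [Set.mem_ofPred_eq, ← hnum]
  constructor
  · intro h
    obtain ⟨s, hs⟩ := (tendsto_card_stage.eventually (lt_mem_nhds h)).exists
    refine ⟨(s, (stage S a s).toList), ⟨Finset.nodup_toList _, by simpa using hs⟩, fun σ hσ => ?_⟩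
    exact mem_stage.1 (by simpa using hσ)
  · rintro ⟨⟨s, l⟩, ⟨h1, h2⟩, h3⟩
    refine h2.trans_le ?_
    classical
    rw [← List.toFinset_card_of_nodup h1,
      ← lam_openOf_finset (F := l.toFinset) fun σ hσ => (h3 σ (by simpa using hσ)).1]
    exact measure_mono (openOf_subset_of_mem_upClosure fun σ hσ => (h3 σ (by simpa using hσ)).2)

end

/-! ### Tails of Martin-Löf random sequences -/

/-- Kučera's argument: if every tail of a Martin-Löf random sequence has a prefix in `S`, then `S`
is not contained, even up to null sets, in a c.e. open set of measure less than one. -/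
theorem exists_lam_app_preimage_lt_one {X : Cantor} (hX : X ∈ MLR ∅) {S : Set Str}
    (hS : ∀ k, shift k X ∈ openOf S) {M : Set Cantor} (hM : CEOpen zeroOracle M) (h : lam M < 1) :
    ∃ τ ∈ S, lam (app τ ⁻¹' M) < 1 := by
  by_contra! hc
  have hMm := hM.measurableSet
  -- A threshold `q` strictly between `lam M` and `1`, of the form required by `SigmaIn.lam_gt`.
  obtain ⟨p, hp⟩ := ENNReal.exists_inv_two_pow_lt (a := 1 - lam M) (tsub_pos_of_lt h).ne'
  have hq : lam M < 1 - (2⁻¹ : ℝ≥0∞) ^ p :=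
    lt_tsub_iff_right.2 (by rw [add_comm]; exact lt_tsub_iff_right.1 hp)
  set q := 1 - (2⁻¹ : ℝ≥0∞) ^ p
  have hq1 : q < 1 := ENNReal.sub_lt_self (by simp) (by simp) (by simp)
  let W : Set Str := {τ | q < lam (app τ ⁻¹' M)}
  have hW : CEOpen zeroOracle (openOf W) := by
    obtain ⟨T, hT, rfl⟩ := hM
    have hT' : SigmaIn zeroOracle {p : Unit × Str | p.2 ∈ T} := hT.preimage Primrec.snd
    have h1 : SigmaIn zeroOracle {p : Str × Str | ((), p.1 ++ p.2) ∈
        upClosure {p : Unit × Str | p.2 ∈ T}} :=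
      hT'.upClosure.preimage (f := fun p : Str × Str => ((), p.1 ++ p.2))
        (Primrec.pair (Primrec.const ()) Primrec.list_append)
    refine ⟨_, h1.lam_gt p, ?_⟩
    congr 1
    ext τ
    have : app τ ⁻¹' openOf T = openOf {σ | (τ, σ) ∈ {p : Str × Str | ((), p.1 ++ p.2) ∈
        upClosure {p : Unit × Str | p.2 ∈ T}}} := by
      ext Y
      have := mem_openOf_iff_upClosure (S := {p : Unit × Str | p.2 ∈ T}) (a := ())
        (X := app τ Y) τ.length
      rw [Set.mem_preimage, mem_openOf (S := {x | _})]
      simp only [initSeg_app_add] at this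
      exact this
    simp only [W, Set.mem_ofPred_eq, this]
    rfl
  -- Markov's inequality: `M` fills more than the fraction `q` of each of the disjoint cylinders
  -- given by the minimal elements of `W`.
  have hWq : q * lam (openOf W) ≤ lam M := by
    have hpf := prefixFree_minimals W
    rw [← openOf_minimals, hpf.lam_openOf, ← ENNReal.tsum_mul_left]
    calc ∑' σ : minimals W, q * (2⁻¹ : ℝ≥0∞) ^ (σ : Str).length
        ≤ ∑' σ : minimals W, lam (M ∩ cyl (σ : Str)) := by
          refine ENNReal.tsum_le_tsum fun σ => ?_
          rw [lam_inter_cyl hMm, mul_comm]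
          gcongr
          exact σ.2.1.le
      _ = lam (⋃ σ ∈ minimals W, M ∩ cyl σ) := by
          rw [measure_biUnion (Set.to_countable _)
            (hpf.pairwiseDisjoint.mono fun σ => Set.inter_subset_right)
            fun σ _ => hMm.inter (measurableSet_cyl σ)]
      _ ≤ lam M := measure_mono (Set.iUnion₂_subset fun _ _ => Set.inter_subset_left)
  have hW1 : lam (openOf W) < 1 := by
    by_contra! hge
    refine absurd (hWq.trans_lt hq) (not_lt.2 ?_)
    calc q = q * 1 := (mul_one q).symm
      _ ≤ _ := by gcongr
  obtain ⟨T, hT, hTpf, hTW⟩ := hW.exists_prefixFree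
  rw [hTW] at hW1
  obtain ⟨c, hc'⟩ := ((ENNReal.tendsto_pow_atTop_nhds_zero_of_lt_one hW1).eventually
    (gt_mem_nhds (show (0 : ℝ≥0∞) < 2⁻¹ by simp))).exists
  refine hX _ (isMLTest_iter (O := ∅) (fun _ => ceIn_empty_iff_sigmaIn) hT hTpf hc'.le) ?_
  -- By the assumption for contradiction `M` has full conditional measure above each `τ ∈ S`. Every
  -- tail of `X` thus has a prefix in `T`, and repeatedly removing such prefixes puts `X` into all
  -- the sets `iter T n`.
  have hSW : S ⊆ W := fun τ hτ => hq1.trans_le (hc τ hτ)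
  have : ∀ n k, shift k X ∈ iter T n := by
    intro n
    induction n with
    | zero => exact fun k => Set.mem_univ _
    | succ n ih =>
      intro k
      have hk : shift k X ∈ openOf T := hTW ▸ openOf_mono hSW (hS k)
      obtain ⟨m, hm⟩ := mem_openOf.1 hk
      exact mem_iter_succ.2 ⟨m, hm, by rw [shift_shift]; exact ih _⟩
  exact Set.mem_iInter.2 fun n => by simpa using this (c * n) 0

/-! ### Partial relativization -/

theorem CEOpen.of_index (e : ℕ) : CEOpen zeroOracle (ceOpen e) := by
  refine ⟨_, ceIn_empty_iff_sigmaIn.1 ?_, rfl⟩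
  refine ⟨fun σ => ((Denumerable.ofNat Nat.Partrec.Code e).eval (Encodable.encode σ)).map
    fun _ => (), ?_, ?_⟩
  · refine recursiveIn_empty_iff.2 ?_
    exact (Nat.Partrec.Code.eval_part.comp (Computable.const _) Computable.encode).map
      (Computable.const ()).to₂
  · ext σ
    rfl

theorem CEOpen.empty : CEOpen zeroOracle ∅ := by
  refine ⟨{_σ | 0 = 1}, SigmaIn.of_primrecPred
    (Primrec.eq.comp (Primrec.const 0) (Primrec.const 1)), ?_⟩
  ext X
  simp [mem_openOf]

theorem countable_sigmaIn {α : Type} [Primcodable α] (A : Cantor) :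
    {S : Set α | SigmaIn A S}.Countable := by
  let F : Nat.Partrec.Code → Set α := fun c =>
    {x | ∃ k, Encodable.encode true ∈ c.eval (Encodable.encode (initSeg A k, x))}
  refine (Set.countable_range F).mono ?_
  rintro S ⟨R, hR, rfl⟩
  classical
  have h : Partrec fun p : Str × α => (Part.some (decide (R p.1 p.2)) : Part Bool) :=
    (PrimrecPred.decide hR).to_comp.partrec
  obtain ⟨c, hc⟩ := Nat.Partrec.Code.exists_code.1 h
  refine ⟨c, ?_⟩
  ext x
  simp only [F, hc, Set.mem_ofPred_eq, Encodable.encodek]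
  refine exists_congr fun k => ?_
  by_cases hk : R (initSeg A k) x <;> simp [hk]

/-- A test is determined by the graph of its index function, which is c.e. in `Z`. The forcing uses
the `Z`-computability of that function only through this count. -/
theorem countable_isPartialMLTest (Z : Cantor) : {U | IsPartialMLTest Z U}.Countable := by
  let G : Set (ℕ × ℕ) → ℕ → Set Cantor := fun T n => ⋃ e ∈ {e | (n, e) ∈ T}, ceOpen e
  refine ((countable_sigmaIn Z).image G).mono ?_
  rintro U ⟨⟨f, hf, hU⟩, -⟩
  refine ⟨_, SigmaIn.graph_of_recursiveIn hf, ?_⟩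
  funext n
  simp [G, hU]

/-- By the s-m-n theorem (`curry`), an unrelativized test has a computable sequence of indices. -/
theorem partialMLR_subset_MLR (Z : Cantor) : PartialMLR Z ⊆ MLR ∅ := by
  intro X hX U hU
  refine hX U ⟨?_, hU.measure_le⟩
  obtain ⟨S, ⟨f, hf, hS⟩, hUS⟩ := hU.ce
  rw [recursiveIn_empty_iff] at hf
  have hf' : Partrec fun p : ℕ × Str => f p := hf
  obtain ⟨c, hc⟩ := Nat.Partrec.Code.exists_code.1 hf'
  refine ⟨fun n => Encodable.encode (c.curry n), ?_, fun n => ?_⟩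
  · exact (Primrec.encode.comp (Nat.Partrec.Code.primrec₂_curry.comp
      (Primrec.const c) Primrec.id)).computableIn
  · rw [hUS, ceOpen]
    congr 1
    ext σ
    have h1 : σ ∈ S n ↔ (n, σ) ∈ f.Dom := by
      rw [← hS]
      rfl
    rw [h1]
    simp only [Denumerable.ofNat_encode, Nat.Partrec.Code.eval_curry, hc, Set.mem_ofPred_eq]
    have : Nat.pair n (Encodable.encode σ) = Encodable.encode (n, σ) := by simp
    rw [this, Encodable.encodek]
    simp [PFun.mem_dom, Part.dom_iff_mem]

/-! ### Forcing with c.e. open sets -/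

/-- Finitely many blocks in `S`, and a c.e. open set that does not cover, up to a null set, the
cylinder of their concatenation. -/
structure Condition (S : Set Str) where
  blocks : List Str
  avoid : Set Cantor
  mem : ∀ σ ∈ blocks, σ ∈ S
  ce : CEOpen zeroOracle avoid
  lam_lt : lam (app blocks.flatten ⁻¹' avoid) < 1

/-- A late enough member of the test is so small that, even conditionally on the blocks chosen so
far, adding it to the set to avoid leaves positive measure. The next block comes from `hS`, applied
to the enlarged set as seen above these blocks. -/
theorem Condition.exists_extension {S : Set Str}
    (hS : ∀ M, CEOpen zeroOracle M → lam M < 1 → ∃ τ ∈ S, lam (app τ ⁻¹' M) < 1)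
    (p : Condition S) {U : ℕ → Set Cantor} (hU : ∀ n, CEOpen zeroOracle (U n))
    (hUm : ∀ n, lam (U n) ≤ (2⁻¹ : ℝ≥0∞) ^ n) :
    ∃ q : Condition S, (∃ τ ∈ S, q.blocks = p.blocks ++ [τ]) ∧ p.avoid ⊆ q.avoid ∧
      ∃ n, U n ⊆ q.avoid := by
  set σ := p.blocks.flatten with hσ
  obtain ⟨m, hm⟩ := ENNReal.exists_inv_two_pow_lt (a := 1 - lam (app σ ⁻¹' p.avoid))
    (tsub_pos_of_lt p.lam_lt).ne'
  -- Conditioning on `σ` costs a factor of at most `2 ^ σ.length`, which the shift of the index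
  -- absorbs.
  have hU' : lam (app σ ⁻¹' U (σ.length + m)) ≤ (2⁻¹ : ℝ≥0∞) ^ m := by
    refine (lam_app_preimage_le (hU _).measurableSet σ).trans ?_
    calc 2 ^ σ.length * lam (U (σ.length + m))
        ≤ 2 ^ σ.length * (2⁻¹ : ℝ≥0∞) ^ (σ.length + m) := by gcongr; exact hUm _
      _ = (2 * 2⁻¹ : ℝ≥0∞) ^ σ.length * 2⁻¹ ^ m := by rw [mul_pow, pow_add, mul_assoc]
      _ = _ := by rw [ENNReal.mul_inv_cancel (by simp) (by simp), one_pow, one_mul]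
  have hK : CEOpen zeroOracle (p.avoid ∪ U (σ.length + m)) := p.ce.union (hU _)
  have hlt : lam (app σ ⁻¹' (p.avoid ∪ U (σ.length + m))) < 1 := by
    rw [Set.preimage_union]
    refine (measure_union_le _ _).trans_lt ?_
    rw [add_comm]
    exact lt_tsub_iff_right.1 (hU'.trans_lt hm)
  obtain ⟨τ, hτ, hlt'⟩ := hS _ (hK.app_preimage σ) hlt
  have happ : app τ ⁻¹' (app σ ⁻¹' (p.avoid ∪ U (σ.length + m))) =
      app (p.blocks ++ [τ]).flatten ⁻¹' (p.avoid ∪ U (σ.length + m)) := by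
    ext Y
    simp [app_append, hσ]
  refine ⟨⟨p.blocks ++ [τ], _, ?_, hK, happ ▸ hlt'⟩, ⟨τ, hτ, rfl⟩, Set.subset_union_left,
    _, Set.subset_union_right⟩
  intro ρ hρ
  rcases List.mem_append.1 hρ with h | h
  · exact p.mem ρ h
  · rw [List.mem_singleton.1 h]
    exact hτ

/-- `Y` is the limit of a chain of conditions, the `i`-th step of which handles the `i`-th test. As
`[] ∉ S`, each step lengthens the string, so the limit is infinite. -/
theorem exists_mem_partialMLR (Z : Cantor) {S : Set Str} (hne : [] ∉ S)
    (hS : ∀ M, CEOpen zeroOracle M → lam M < 1 → ∃ τ ∈ S, lam (app τ ⁻¹' M) < 1) :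
    ∃ Y ∈ PartialMLR Z, ∀ n, Y ∈ iter S n := by
  obtain ⟨tests, htests⟩ := Set.countable_iff_exists_subset_range.1 (countable_isPartialMLTest Z)
  have hstep : ∀ (i : ℕ) (p : Condition S), ∃ q : Condition S,
      (∃ τ ∈ S, q.blocks = p.blocks ++ [τ]) ∧ p.avoid ⊆ q.avoid ∧
      (IsPartialMLTest Z (tests i) → ∃ n, tests i n ⊆ q.avoid) := by
    intro i p
    by_cases hi : IsPartialMLTest Z (tests i)
    · obtain ⟨f, -, hf⟩ := hi.index
      obtain ⟨q, h1, h2, h3⟩ := p.exists_extension hS (U := tests i)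
        (fun n => by rw [hf]; exact CEOpen.of_index _) hi.measure_le
      exact ⟨q, h1, h2, fun _ => h3⟩
    -- If the `i`-th sequence is not a test, only a block is added, with empty sets in place of the
    -- test.
    · obtain ⟨q, h1, h2, -⟩ := p.exists_extension hS (U := fun _ => ∅)
        (fun n => CEOpen.empty) (by simp)
      exact ⟨q, h1, h2, fun h => absurd h hi⟩
  choose next hnext hmono hcatch using hstep
  let p₀ : Condition S := ⟨[], ∅, by simp, CEOpen.empty, by simp⟩
  let p : ℕ → Condition S := fun n => n.rec p₀ next
  have hps : ∀ n, p (n + 1) = next n (p n) := fun n => rfl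
  let s : ℕ → Str := fun n => (p n).blocks.flatten
  have hs1 : ∀ n, ∃ τ, τ ≠ [] ∧ s (n + 1) = s n ++ τ := by
    intro n
    obtain ⟨τ, hτ, h⟩ := hnext n (p n)
    refine ⟨τ, fun h0 => hne (h0 ▸ hτ), ?_⟩
    simp only [s, hps, h]
    simp
  have hsp : ∀ m n, m ≤ n → s m <+: s n := by
    intro m n h
    induction h with
    | refl => exact List.prefix_rfl
    | step _ ih =>
      obtain ⟨τ, -, h⟩ := hs1 _
      exact ih.trans (by rw [h]; exact List.prefix_append _ _)
  have hsl : ∀ n, n ≤ (s n).length := by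
    intro n
    induction n with
    | zero => simp
    | succ n ih =>
      obtain ⟨τ, h0, h⟩ := hs1 n
      have := List.length_pos_of_ne_nil h0
      rw [h, List.length_append]
      omega
  have hsa : ∀ m n, m ≤ n → (p m).avoid ⊆ (p n).avoid := by
    intro m n h
    induction h with
    | refl => exact subset_rfl
    | step _ ih => exact ih.trans (hmono _ _)
  let Y : Cantor := fun i => ((s (i + 1))[i]?).getD false
  have hY : ∀ n, initSeg Y (s n).length = s n := by
    intro n
    refine List.ext_getElem (by simp) fun i h1 h2 => ?_
    have h3 : i < (s (i + 1)).length := hsl (i + 1)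
    have : (s (i + 1))[i] = (s n)[i] := by
      rcases le_total (i + 1) n with h | h
      · exact (hsp _ _ h).getElem h3
      · exact ((hsp _ _ h).getElem h2).symm
    simp [initSeg, Y, h3, this]
  have hlen : ∀ n, (p n).blocks.length = n := by
    intro n
    induction n with
    | zero => rfl
    | succ n ih =>
      obtain ⟨τ, -, h⟩ := hnext n (p n)
      rw [hps, h, List.length_append, ih]
      rfl
  refine ⟨Y, ?_, fun n => mem_iter_iff.2 ⟨(p n).blocks, hlen n, (p n).mem, hY n⟩⟩
  intro U hU hYU
  obtain ⟨i, rfl⟩ := htests hU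
  obtain ⟨n, hn⟩ := hcatch i (p i) hU
  have hYK : Y ∈ (p (i + 1)).avoid := hn (Set.mem_iInter.1 hYU n)
  obtain ⟨T, -, hT⟩ := (p (i + 1)).ce
  rw [hT] at hYK
  obtain ⟨m, hm⟩ := mem_openOf.1 hYK
  -- If `Y` were in the open set to avoid, that set would contain the cylinder of some later
  -- condition, contradicting `lam_lt` there.
  have h1 : cyl (s (max m (i + 1))) ⊆ (p (max m (i + 1))).avoid := by
    refine Set.Subset.trans ?_ (hsa _ _ (le_max_right m (i + 1)))
    rw [hT]
    refine Set.Subset.trans (cyl_anti ?_) (cyl_subset_openOf hm)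
    rw [← hY]
    exact initSeg_prefix Y ((le_max_left _ _).trans (hsl _))
  have h2 : app (s (max m (i + 1))) ⁻¹' (p (max m (i + 1))).avoid = Set.univ :=
    Set.eq_univ_of_forall fun X => h1 (app_mem_cyl _ X)
  have h3 := (p (max m (i + 1))).lam_lt
  rw [h2, measure_univ] at h3
  exact lt_irrefl _ h3

/-! ### Tails of the elements of a test -/

/-- An enumeration of the strings, the `i`-th one of length at most `i`. -/
def enumStr (i : ℕ) : Str := ((Encodable.decode (α := Str) i).getD []).take i

theorem length_enumStr_le (i : ℕ) : (enumStr i).length ≤ i := by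
  simp [enumStr]

theorem enumStr_encode (σ : Str) : enumStr (Encodable.encode σ) = σ := by
  simp [enumStr, Encodable.length_le_encode σ]

theorem primrec_enumStr : Primrec enumStr :=
  Primrec.list_take.comp Primrec.id
    (Primrec.option_getD.comp Primrec.decode (Primrec.const []))

section
variable {S : Set (ℕ × Str)}

/-- For `V n` the open set generated by the `n`-th member of `S`, this is the union of the sets
`{Y | enumStr i ⌢ Y ∈ V (2 i + 2)}`. -/
def tails (S : Set (ℕ × Str)) : Set Cantor :=
  openOf {τ | ∃ i, (2 * i + 2, enumStr i ++ τ) ∈ upClosure S}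

theorem ceOpen_tails {A : Cantor} (hS : SigmaIn A S) : CEOpen A (tails S) := by
  have h : SigmaIn A {p : Str × ℕ | (2 * p.2 + 2, enumStr p.2 ++ p.1) ∈ upClosure S} :=
    hS.upClosure.preimage (f := fun p : Str × ℕ => (2 * p.2 + 2, enumStr p.2 ++ p.1))
      (Primrec.pair (Primrec.nat_add.comp (Primrec.nat_mul.comp (Primrec.const 2) Primrec.snd)
        (Primrec.const 2)) (Primrec.list_append.comp (primrec_enumStr.comp Primrec.snd)
        Primrec.fst))
  exact ⟨_, h.exists, rfl⟩

theorem mem_tails {X : Cantor} :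
    X ∈ tails S ↔ ∃ i, app (enumStr i) X ∈ openOf {σ | (2 * i + 2, σ) ∈ S} := by
  have h : ∀ i, app (enumStr i) X ∈ openOf {σ | (2 * i + 2, σ) ∈ S} ↔
      ∃ n, (2 * i + 2, enumStr i ++ initSeg X n) ∈ upClosure S := fun i => by
    simp only [mem_openOf_iff_upClosure (enumStr i).length, initSeg_app_add]
  simp only [h]
  exact mem_openOf.trans exists_comm

theorem shift_mem_tails {X : Cantor} (hX : ∀ n, X ∈ openOf {σ | (n, σ) ∈ S}) (k : ℕ) :
    shift k X ∈ tails S := by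
  refine mem_tails.2 ⟨Encodable.encode (initSeg X k), ?_⟩
  rw [enumStr_encode, app_initSeg_shift]
  exact hX _

/-- The factor `2 ^ i` bounds the loss from conditioning on `enumStr i`, of length at most `i`. The
index `2 * i + 2` in `tails` is chosen to make up for it and leave one half in total. -/
theorem tsum_two_pow_mul : ∑' i : ℕ, (2 : ℝ≥0∞) ^ i * 2⁻¹ ^ (2 * i + 2) = 2⁻¹ := by
  have h : ∀ i : ℕ, (2 : ℝ≥0∞) ^ i * 2⁻¹ ^ (2 * i + 2) = 2⁻¹ ^ i * (2⁻¹ * 2⁻¹) := by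
    intro i
    calc (2 : ℝ≥0∞) ^ i * 2⁻¹ ^ (2 * i + 2) = (2 * 2⁻¹ : ℝ≥0∞) ^ i * (2⁻¹ ^ i * (2⁻¹ * 2⁻¹)) := by
          rw [mul_pow, mul_assoc]
          congr 1
          ring
      _ = _ := by rw [ENNReal.mul_inv_cancel (by simp) (by simp), one_pow, one_mul]
  simp only [h]
  rw [ENNReal.tsum_mul_right, ENNReal.tsum_geometric_two, ← mul_assoc,
    ENNReal.mul_inv_cancel (by simp) (by simp), one_mul]

theorem lam_app_enumStr_le {B : Set Cantor} (hB : MeasurableSet B) (i : ℕ) :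
    lam (app (enumStr i) ⁻¹' B) ≤ 2 ^ i * lam B := by
  refine (lam_app_preimage_le hB _).trans ?_
  gcongr
  · simp
  · exact length_enumStr_le i

theorem lam_tails_le (hS : ∀ n, lam (openOf {σ | (n, σ) ∈ S}) ≤ (2⁻¹ : ℝ≥0∞) ^ n) :
    lam (tails S) ≤ 2⁻¹ := by
  have h : tails S = ⋃ i, app (enumStr i) ⁻¹' openOf {σ | (2 * i + 2, σ) ∈ S} := by
    ext X
    simp only [mem_tails, Set.mem_iUnion, Set.mem_preimage]
  rw [h, ← tsum_two_pow_mul]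
  refine (measure_iUnion_le _).trans (ENNReal.tsum_le_tsum fun i => ?_)
  refine (lam_app_enumStr_le (measurableSet_openOf _) i).trans ?_
  gcongr
  exact hS _

end

/-! ### Transfer to `PartialMLR Z`, and the Martin-Löf case -/

theorem nil_notMem_of_lam_lt_one {S : Set Str} (h : lam (openOf S) < 1) : [] ∉ S := by
  intro h0
  have : openOf S = Set.univ := Set.eq_univ_of_forall fun X => mem_openOf.2 ⟨0, h0⟩
  rw [this, measure_univ] at h
  exact lt_irrefl _ h

/-- The common core of the Martin-Löf and Schnorr cases: Kučera's argument supplies the hypothesis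
of the forcing. -/
theorem exists_mem_partialMLR_iter (Z : Cantor) {A : Cantor} {X : Cantor} (hX : X ∈ MLR ∅)
    {U : Set Cantor} (hU : CEOpen A U) (hU1 : lam U < 1) (hXU : ∀ k, shift k X ∈ U) :
    ∃ S, SigmaIn A S ∧ PrefixFree S ∧ U = openOf S ∧ ∃ Y ∈ PartialMLR Z, ∀ n, Y ∈ iter S n := by
  obtain ⟨S, hS, hpf, rfl⟩ := hU.exists_prefixFree
  exact ⟨S, hS, hpf, rfl, exists_mem_partialMLR Z (nil_notMem_of_lam_lt_one hU1)
    fun M hM h => exists_lam_app_preimage_lt_one hX hXU hM h⟩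

theorem MLR_subset_of_partialMLR_subset {Z A : Cantor}
    (h : PartialMLR Z ⊆ MLR {oracle A}) : MLR ∅ ⊆ MLR {oracle A} := by
  intro X hX V hV hXV
  obtain ⟨T, hT, hVT⟩ := hV.ce
  rw [ceIn_iff_sigmaIn] at hT
  have hle := lam_tails_le (S := {p : ℕ × Str | p.2 ∈ T p.1}) fun n => by
    simpa [hVT] using hV.measure_le n
  obtain ⟨S, hS, hpf, hUS, Y, hY, hYS⟩ := exists_mem_partialMLR_iter Z hX (ceOpen_tails hT)
    (hle.trans_lt (by simp)) (shift_mem_tails fun n => by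
      simpa [hVT] using Set.mem_iInter.1 hXV n)
  rw [hUS] at hle
  refine h hY _ (isMLTest_iter (fun _ => ceIn_iff_sigmaIn) hS hpf (c := 1) (by simpa using hle)) ?_
  exact Set.mem_iInter.2 fun n => hYS _

theorem MLR_anti {O₁ O₂ : Set (ℕ →. ℕ)} (h : O₁ ⊆ O₂) : MLR O₂ ⊆ MLR O₁ := by
  intro X hX U hU
  refine hX U ⟨hU.antitone, ?_, hU.measure_le⟩
  obtain ⟨S, ⟨f, hf, hS⟩, hUS⟩ := hU.ce
  exact ⟨S, ⟨f, hf.mono h, hS⟩, hUS⟩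

/-! ### Lexicographic initial segments of Cantor space -/

/-- The natural number with binary expansion `σ`. -/
def binVal (σ : Str) : ℕ := σ.foldl (fun m b => 2 * m + b.toNat) 0

theorem binVal_concat (σ : Str) (b : Bool) : binVal (σ ++ [b]) = 2 * binVal σ + b.toNat := by
  simp [binVal]

theorem primrec_binVal : Primrec binVal := by
  refine Primrec.list_foldl (f := fun σ : Str => σ) (g := fun _ => 0)
    (h := fun _ p => 2 * p.1 + p.2.toNat) Primrec.id (Primrec.const 0) ?_
  exact Primrec.nat_add.comp (Primrec.nat_mul.comp (Primrec.const 2)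
    (Primrec.fst.comp Primrec.snd))
    ((Primrec.dom_finite Bool.toNat).comp (Primrec.snd.comp Primrec.snd))

theorem binVal_initSeg_succ (X : Cantor) (n : ℕ) :
    binVal (initSeg X (n + 1)) = 2 * binVal (initSeg X n) + (X n).toNat := by
  rw [initSeg_succ, binVal_concat]

theorem binVal_initSeg_lt (X : Cantor) (n : ℕ) : binVal (initSeg X n) < 2 ^ n := by
  induction n with
  | zero => simp [initSeg, binVal]
  | succ n ih =>
    rw [binVal_initSeg_succ, pow_succ]
    have := Bool.toNat_lt (X n)
    omega

theorem initSeg_eq_of_binVal_eq {X Y : Cantor} {n : ℕ}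
    (h : binVal (initSeg X n) = binVal (initSeg Y n)) : initSeg X n = initSeg Y n := by
  induction n with
  | zero => simp [initSeg]
  | succ n ih =>
    rw [binVal_initSeg_succ, binVal_initSeg_succ] at h
    have h1 := Bool.toNat_lt (X n)
    have h2 := Bool.toNat_lt (Y n)
    have h3 : X n = Y n := by
      have : (X n).toNat = (Y n).toNat := by omega
      cases hx : X n <;> cases hy : Y n <;> simp_all
    rw [initSeg_succ, initSeg_succ, ih (by omega), h3]

/-- The sequences among the lexicographically first `j` cylinders of length `m`. -/
def lexInit (m j : ℕ) : Set Cantor := {X | binVal (initSeg X m) < j}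

theorem mem_lexInit {m j : ℕ} {X : Cantor} : X ∈ lexInit m j ↔ binVal (initSeg X m) < j := Iff.rfl

theorem lexInit_zero (m : ℕ) : lexInit m 0 = ∅ := by
  ext X
  simp [mem_lexInit]

theorem lexInit_two_pow (m : ℕ) : lexInit m (2 ^ m) = Set.univ :=
  Set.eq_univ_of_forall fun X => binVal_initSeg_lt X m

theorem lexInit_mono (m : ℕ) {i j : ℕ} (h : i ≤ j) : lexInit m i ⊆ lexInit m j :=
  fun _ hX => lt_of_lt_of_le hX h

theorem lexInit_add (m d j : ℕ) : lexInit (m + d) (2 ^ d * j) = lexInit m j := by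
  induction d with
  | zero => simp
  | succ d ih =>
    rw [← ih]
    ext X
    rw [mem_lexInit, mem_lexInit, ← add_assoc, binVal_initSeg_succ, pow_succ]
    have := Bool.toNat_lt (X (m + d))
    have h : 2 ^ d * 2 * j = 2 * (2 ^ d * j) := by ring
    rw [h]
    omega

theorem lexInit_total (m i n j : ℕ) : lexInit m i ⊆ lexInit n j ∨ lexInit n j ⊆ lexInit m i := by
  rw [← lexInit_add m n i, ← lexInit_add n m j, add_comm n m]
  rcases le_total (2 ^ n * i) (2 ^ m * j) with h | h
  · exact Or.inl (lexInit_mono _ h)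
  · exact Or.inr (lexInit_mono _ h)

theorem lam_binVal_eq_le (m j : ℕ) : lam {X | binVal (initSeg X m) = j} ≤ (2⁻¹ : ℝ≥0∞) ^ m := by
  rcases Set.eq_empty_or_nonempty {X : Cantor | binVal (initSeg X m) = j} with h | ⟨X, hX⟩
  · simp [h]
  · have : {Y : Cantor | binVal (initSeg Y m) = j} ⊆ cyl (initSeg X m) := by
      intro Y hY
      rw [mem_cyl, length_initSeg]
      exact initSeg_eq_of_binVal_eq (hY.trans hX.symm)
    refine (measure_mono this).trans ?_
    rw [lam_cyl, length_initSeg]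

/-! ### Enlarging the set of tails to measure exactly one half -/

section
variable {S : Set (ℕ × Str)} {A : Cantor}

/-- The finite information showing that `tails S ∪ lexInit m j` has measure less than one half,
if the `n`-th set of the family has measure `2 ^ (-n)`: a length `s`, a list `w.2.1` of indexed
strings that generate parts of the family, and a list `w.2.2` of strings whose cylinders
avoid `lexInit m j` and what these parts contribute to `tails S`. -/
def IsCertificate (S : Set (ℕ × Str)) (q : ℕ × ℕ) (w : ℕ × List (ℕ × Str) × List Str) : Prop :=
  (q.1 ≤ w.1 ∧ w.2.1.Nodup ∧ w.2.2.Nodup ∧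
    2 ^ w.1 < w.2.2.length + (w.2.1.map fun p => 2 ^ p.1).sum ∧
    ∀ c ∈ w.2.2, c.length = w.1 ∧ q.2 ≤ binVal (c.take q.1) ∧
      ∀ p ∈ w.2.1, ¬ p.2 <+: enumStr p.1 ++ c) ∧
  ∀ p ∈ w.2.1, p.2.length = w.1 ∧ (2 * p.1 + 2, p.2) ∈ upClosure S

theorem primrec_list_sum : Primrec fun l : List ℕ => l.sum := by
  have : Primrec fun l : List ℕ => l.foldr (fun a b => a + b) 0 :=
    Primrec.list_foldr (h := fun _ p => p.1 + p.2) Primrec.id (Primrec.const 0)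
      (Primrec.nat_add.comp (Primrec.fst.comp Primrec.snd) (Primrec.snd.comp Primrec.snd))
  exact this.of_eq fun l => rfl

theorem sigmaIn_isCertificate (hS : SigmaIn A S) :
    SigmaIn A {q : ℕ × ℕ | ∃ w, IsCertificate S q w} := by
  have hF : Primrec fun x : (ℕ × ℕ) × ℕ × List (ℕ × Str) × List Str => x.2.2.1 :=
    Primrec.fst.comp (Primrec.snd.comp Primrec.snd)
  have hC : Primrec fun x : (ℕ × ℕ) × ℕ × List (ℕ × Str) × List Str => x.2.2.2 :=
    Primrec.snd.comp (Primrec.snd.comp Primrec.snd)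
  have hs : Primrec fun x : (ℕ × ℕ) × ℕ × List (ℕ × Str) × List Str => x.2.1 :=
    Primrec.fst.comp Primrec.snd
  have h1 : PrimrecRel fun (p : ℕ × Str) (c : Str) => ¬ p.2 <+: enumStr p.1 ++ c :=
    PrimrecPred.not (primrecRel_isPrefix.comp (Primrec.snd.comp Primrec.fst)
      (Primrec.list_append.comp (primrec_enumStr.comp (Primrec.fst.comp Primrec.fst)) Primrec.snd))
  have h2 : PrimrecRel fun (c : Str) (x : (ℕ × ℕ) × ℕ × List (ℕ × Str) × List Str) =>
      c.length = x.2.1 ∧ x.1.2 ≤ binVal (c.take x.1.1) ∧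
        ∀ p ∈ x.2.2.1, ¬ p.2 <+: enumStr p.1 ++ c := by
    refine PrimrecPred.and (Primrec.eq.comp (Primrec.list_length.comp Primrec.fst)
      (hs.comp Primrec.snd)) (PrimrecPred.and ?_ ?_)
    · exact Primrec.nat_le.comp (Primrec.snd.comp (Primrec.fst.comp Primrec.snd))
        (primrec_binVal.comp (Primrec.list_take.comp
          (Primrec.fst.comp (Primrec.fst.comp Primrec.snd)) Primrec.fst))
    · exact h1.forall_mem_list.comp (hF.comp Primrec.snd) Primrec.fst
  have h3 : PrimrecPred fun x : (ℕ × ℕ) × ℕ × List (ℕ × Str) × List Str =>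
      x.1.1 ≤ x.2.1 ∧ x.2.2.1.Nodup ∧ x.2.2.2.Nodup ∧
      2 ^ x.2.1 < x.2.2.2.length + (x.2.2.1.map fun p => 2 ^ p.1).sum ∧
      ∀ c ∈ x.2.2.2, c.length = x.2.1 ∧ x.1.2 ≤ binVal (c.take x.1.1) ∧
        ∀ p ∈ x.2.2.1, ¬ p.2 <+: enumStr p.1 ++ c := by
    refine PrimrecPred.and (Primrec.nat_le.comp (Primrec.fst.comp Primrec.fst) hs)
      (PrimrecPred.and (primrecPred_nodup.comp hF) (PrimrecPred.and (primrecPred_nodup.comp hC)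
      (PrimrecPred.and ?_ (h2.forall_mem_list.comp hC Primrec.id))))
    refine Primrec.nat_lt.comp (primrec_two_pow.comp hs) (Primrec.nat_add.comp
      (Primrec.list_length.comp hC) (primrec_list_sum.comp (Primrec.list_map hF ?_)))
    exact primrec_two_pow.comp (Primrec.fst.comp Primrec.snd)
  have h4 : SigmaIn A {y : (ℕ × Str) × ℕ | y.1.2.length = y.2 ∧
      (2 * y.1.1 + 2, y.1.2) ∈ upClosure S} := by
    refine SigmaIn.inter (S := {y : (ℕ × Str) × ℕ | y.1.2.length = y.2})
      (SigmaIn.of_primrecPred (Primrec.eq.comp (Primrec.list_length.comp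
        (Primrec.snd.comp Primrec.fst)) Primrec.snd))
      (hS.upClosure.preimage (f := fun y : (ℕ × Str) × ℕ => (2 * y.1.1 + 2, y.1.2)) ?_)
    exact Primrec.pair (Primrec.nat_add.comp (Primrec.nat_mul.comp (Primrec.const 2)
      (Primrec.fst.comp Primrec.fst)) (Primrec.const 2)) (Primrec.snd.comp Primrec.fst)
  have h5 := h4.forall_mem_list.preimage
    (f := fun x : (ℕ × ℕ) × ℕ × List (ℕ × Str) × List Str => (x.2.2.1, x.2.1))
    (Primrec.pair hF hs)
  exact ((SigmaIn.of_primrecPred h3).inter h5).exists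

theorem two_pow_lt_iff (n s : ℕ) : 2 ^ s < n ↔ 1 < n * (2⁻¹ : ℝ≥0∞) ^ s := by
  rw [← ENNReal.mul_lt_mul_iff_left (c := 2 ^ s) (by simp) (by finiteness), one_mul, mul_assoc,
    ← mul_pow, ENNReal.inv_mul_cancel (by simp) (by simp), one_pow, mul_one]
  exact_mod_cast Iff.rfl

/-- The weighted measures of the test sets add up to exactly `1/2`, so the parts listed in `F` bound
what is still to come. Outside the cylinders of `C` the union has measure at most `1 - lam [C]`;
inside them only the unlisted parts contribute, at most `1/2` minus the weight of `F`. The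
inequality in the certificate makes the total less than `1/2`. -/
theorem lam_lt_of_isCertificate
    (hm : ∀ n, lam (openOf {σ | (n, σ) ∈ S}) = (2⁻¹ : ℝ≥0∞) ^ n) {m j : ℕ}
    {w : ℕ × List (ℕ × Str) × List Str} (hw : IsCertificate S (m, j) w) :
    lam (tails S ∪ lexInit m j) < 2⁻¹ := by
  classical
  obtain ⟨s, F, C⟩ := w
  obtain ⟨⟨hms, hFn, hCn, hlt, hC⟩, hF⟩ := hw
  simp only at hms hFn hCn hlt hC hF
  let V : ℕ → Set Cantor := fun i => openOf {σ | (2 * i + 2, σ) ∈ S}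
  let G : ℕ → Finset Str := fun i => (F.toFinset.filter fun p => p.1 = i).image Prod.snd
  have hG : ∀ i σ, σ ∈ G i ↔ (i, σ) ∈ F := by
    intro i σ
    simp only [G, Finset.mem_image, Finset.mem_filter, List.mem_toFinset]
    constructor
    · rintro ⟨⟨_, _⟩, ⟨h, rfl⟩, rfl⟩
      exact h
    · exact fun h => ⟨(i, σ), ⟨h, rfl⟩, rfl⟩
  have hGs : ∀ i, ∀ σ ∈ G i, σ.length = s := fun i σ hσ => (hF _ ((hG i σ).1 hσ)).1
  have hGV : ∀ i, openOf (G i : Set Str) ⊆ V i := fun i =>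
    openOf_subset_of_mem_upClosure fun σ hσ => (hF _ ((hG i σ).1 hσ)).2
  have hCs : ∀ c ∈ C.toFinset, c.length = s := fun c hc => (hC c (by simpa using hc)).1
  have hcover : tails S ∪ lexInit m j ⊆ (openOf (C.toFinset : Set Str))ᶜ ∪
      ⋃ i, app (enumStr i) ⁻¹' (V i \ openOf (G i : Set Str)) := by
    intro X hX
    by_cases hXC : X ∈ openOf (C.toFinset : Set Str)
    swap
    · exact Or.inl hXC
    rw [mem_openOf_finset hCs, List.mem_toFinset] at hXC
    obtain ⟨-, h2, h3⟩ := hC _ hXC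
    rcases hX with hX | hX
    · obtain ⟨i, hi⟩ := mem_tails.1 hX
      refine Or.inr (Set.mem_iUnion.2 ⟨i, hi, fun hXG => ?_⟩)
      rw [mem_openOf_finset (hGs i), hG] at hXG
      refine h3 _ hXG ?_
      simp only
      rw [← initSeg_app_add]
      exact initSeg_prefix _ (Nat.le_add_left _ _)
    · rw [take_initSeg X hms] at h2
      exact absurd hX (not_lt.2 h2)
  have hbound : lam (tails S ∪ lexInit m j) ≤ lam (openOf (C.toFinset : Set Str))ᶜ +
      ∑' i, 2 ^ i * lam (V i \ openOf (G i : Set Str)) := by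
    refine (measure_mono hcover).trans ((measure_union_le _ _).trans ?_)
    gcongr
    refine (measure_iUnion_le _).trans (ENNReal.tsum_le_tsum fun i => ?_)
    exact lam_app_enumStr_le ((measurableSet_openOf _).diff (measurableSet_openOf _)) i
  have hCl : lam (openOf (C.toFinset : Set Str)) = C.length * (2⁻¹ : ℝ≥0∞) ^ s := by
    rw [lam_openOf_finset hCs, List.toFinset_card_of_nodup hCn]
  have hsum : ((F.map fun p => 2 ^ p.1).sum : ℕ) * (2⁻¹ : ℝ≥0∞) ^ s ≤
      ∑' i, 2 ^ i * lam (openOf (G i : Set Str)) := by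
    have h1 : (F.map fun p => 2 ^ p.1).sum = ∑ i ∈ F.toFinset.image Prod.fst,
        2 ^ i * (G i).card := by
      rw [← List.sum_toFinset _ hFn, ← Finset.sum_fiberwise_of_maps_to (t := F.toFinset.image
        Prod.fst) (g := Prod.fst) fun p hp => Finset.mem_image_of_mem _ hp]
      refine Finset.sum_congr rfl fun i _ => ?_
      rw [Finset.card_image_of_injOn, mul_comm, ← smul_eq_mul, ← Finset.sum_const]
      · refine Finset.sum_congr rfl fun p hp => ?_
        rw [(Finset.mem_filter.1 hp).2]
      · rintro ⟨a, b⟩ h1 ⟨c, d⟩ h2 h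
        have h1 := (Finset.mem_filter.1 h1).2
        have h2 := (Finset.mem_filter.1 h2).2
        simp only at h1 h2 h
        rw [h1, h2, h]
    rw [h1]
    push_cast
    rw [Finset.sum_mul]
    refine le_trans (le_of_eq (Finset.sum_congr rfl fun i _ => ?_)) (ENNReal.sum_le_tsum _)
    rw [lam_openOf_finset (hGs i), mul_assoc]
  have htot : ∑' i, 2 ^ i * lam (V i \ openOf (G i : Set Str)) +
      ∑' i, 2 ^ i * lam (openOf (G i : Set Str)) = 2⁻¹ := by
    rw [← ENNReal.tsum_add, ← tsum_two_pow_mul]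
    refine tsum_congr fun i => ?_
    have h := measure_sdiff_add_inter (μ := lam) (V i)
      (measurableSet_openOf (G i : Set Str))
    rw [Set.inter_eq_right.2 (hGV i)] at h
    rw [← mul_add, ← hm (2 * i + 2), h]
  rw [two_pow_lt_iff] at hlt
  push_cast at hlt
  rw [add_mul, ← hCl] at hlt
  have hfinal : lam (tails S ∪ lexInit m j) + 1 < 2⁻¹ + 1 := by
    calc lam (tails S ∪ lexInit m j) + 1
        < lam (tails S ∪ lexInit m j) + (lam (openOf (C.toFinset : Set Str)) +
          ∑' i, 2 ^ i * lam (openOf (G i : Set Str))) := by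
          refine ENNReal.add_lt_add_left (measure_ne_top _ _) (hlt.trans_le ?_)
          gcongr
          exact_mod_cast hsum
      _ ≤ (lam (openOf (C.toFinset : Set Str))ᶜ +
          ∑' i, 2 ^ i * lam (V i \ openOf (G i : Set Str))) +
          (lam (openOf (C.toFinset : Set Str)) +
          ∑' i, 2 ^ i * lam (openOf (G i : Set Str))) := by gcongr
      _ = (∑' i, 2 ^ i * lam (V i \ openOf (G i : Set Str)) +
          ∑' i, 2 ^ i * lam (openOf (G i : Set Str))) +
          (lam (openOf (C.toFinset : Set Str)) + lam (openOf (C.toFinset : Set Str))ᶜ) := by ring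
      _ = 2⁻¹ + 1 := by
          rw [htot, measure_add_measure_compl (measurableSet_openOf _), measure_univ]
  exact lt_of_add_lt_add_right hfinal

/-- For a large length `s`, the listed parts of finitely many test sets have weight above `t`. Let
`C` consist of all strings of length `s` not yet seen to meet the union. The complement of `[C]`
lies in the union, so `[C]` has measure at least `1 - t`, and the two amounts exceed `1`. -/
theorem exists_isCertificate
    (hm : ∀ n, lam (openOf {σ | (n, σ) ∈ S}) = (2⁻¹ : ℝ≥0∞) ^ n) {m j : ℕ}
    (hlt : lam (tails S ∪ lexInit m j) < 2⁻¹) : ∃ w, IsCertificate S (m, j) w := by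
  classical
  set t := lam (tails S ∪ lexInit m j)
  rw [← tsum_two_pow_mul, ENNReal.tsum_eq_iSup_nat, lt_iSup_iff] at hlt
  obtain ⟨K, hK⟩ := hlt
  have htend : Tendsto (fun s => ∑ i ∈ Finset.range K,
      2 ^ i * ((stage S (2 * i + 2) s).card * (2⁻¹ : ℝ≥0∞) ^ s)) atTop
      (nhds (∑ i ∈ Finset.range K, 2 ^ i * 2⁻¹ ^ (2 * i + 2))) := by
    refine tendsto_finsetSum _ fun i _ => ?_
    rw [← hm]
    exact ENNReal.Tendsto.const_mul tendsto_card_stage (Or.inr (by finiteness))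
  obtain ⟨s, hs, hms⟩ := ((htend.eventually (lt_mem_nhds hK)).and (eventually_ge_atTop m)).exists
  let F : Finset (ℕ × Str) := (Finset.range K ×ˢ strs s).filter
    fun p => (2 * p.1 + 2, p.2) ∈ upClosure S
  let C : Finset Str := (strs s).filter fun c => j ≤ binVal (c.take m) ∧
    ∀ p ∈ F, ¬ p.2 <+: enumStr p.1 ++ c
  have hCs : ∀ c ∈ C, c.length = s := fun c hc => mem_strs.1 (Finset.mem_filter.1 hc).1
  have hFsum : ∑ p ∈ F, 2 ^ p.1 = ∑ i ∈ Finset.range K, 2 ^ i * (stage S (2 * i + 2) s).card := by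
    rw [Finset.sum_filter, Finset.sum_product]
    refine Finset.sum_congr rfl fun i _ => ?_
    rw [← Finset.sum_filter]
    change ∑ _a ∈ (strs s).filter (fun a => (2 * i + 2, a) ∈ upClosure S), 2 ^ i = _
    rw [Finset.sum_const, smul_eq_mul, mul_comm]
    rfl
  have hcompl : (openOf (C : Set Str))ᶜ ⊆ tails S ∪ lexInit m j := by
    intro X hX
    by_contra hXn
    refine hX ((mem_openOf_finset hCs).2 (Finset.mem_filter.2 ⟨by simp, ?_, ?_⟩))
    · rw [take_initSeg X hms]
      exact not_lt.1 fun h => hXn (Or.inr h)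
    · intro p hp hpre
      refine hXn (Or.inl (mem_tails.2 ⟨p.1, ?_⟩))
      rw [← initSeg_app_add] at hpre
      exact (mem_openOf_iff_upClosure (enumStr p.1).length).2
        ⟨s, upClosure_append (Finset.mem_filter.1 hp).2 hpre⟩
  refine ⟨(s, F.toList, C.toList), ⟨hms, F.nodup_toList, C.nodup_toList, ?_, ?_⟩, ?_⟩
  · rw [Finset.length_toList, Finset.sum_map_toList, hFsum, two_pow_lt_iff]
    push_cast
    rw [add_mul, ← lam_openOf_finset hCs, Finset.sum_mul]
    calc 1 = lam (openOf (C : Set Str)) + lam (openOf (C : Set Str))ᶜ := by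
          rw [measure_add_measure_compl (measurableSet_openOf _), measure_univ]
      _ ≤ lam (openOf (C : Set Str)) + t := by gcongr; exact measure_mono hcompl
      _ < _ := by
          refine ENNReal.add_lt_add_left (measure_ne_top _ _) (hs.trans_le (le_of_eq ?_))
          exact Finset.sum_congr rfl fun i _ => (mul_assoc _ _ _).symm
  · intro c hc
    have hc : c ∈ C := by simpa using hc
    refine ⟨hCs c hc, (Finset.mem_filter.1 hc).2.1, fun p hp => ?_⟩
    exact (Finset.mem_filter.1 hc).2.2 p (by simpa using hp)
  · intro p hp
    have hp := Finset.mem_filter.1 (show p ∈ F by simpa using hp)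
    exact ⟨mem_strs.1 (Finset.mem_product.1 hp.1).2, hp.2⟩

/-- All lexicographic initial segments that keep the measure below `1/2` are adjoined. Certificates
make this condition c.e. in `A`. -/
theorem exists_ceOpen_lam_eq_half (hS : SigmaIn A S)
    (hm : ∀ n, lam (openOf {σ | (n, σ) ∈ S}) = (2⁻¹ : ℝ≥0∞) ^ n) :
    ∃ V, CEOpen A V ∧ tails S ⊆ V ∧ lam V = 2⁻¹ := by
  have hcert : ∀ m j, (∃ w, IsCertificate S (m, j) w) ↔ lam (tails S ∪ lexInit m j) < 2⁻¹ :=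
    fun m j => ⟨fun ⟨_, hw⟩ => lam_lt_of_isCertificate hm hw, exists_isCertificate hm⟩
  let I : Set Cantor := openOf {τ | ∃ j, binVal τ < j ∧ ∃ w, IsCertificate S (τ.length, j) w}
  have hI : CEOpen A I := by
    have h1 : SigmaIn A {p : Str × ℕ | binVal p.1 < p.2} :=
      SigmaIn.of_primrecPred (Primrec.nat_lt.comp (primrec_binVal.comp Primrec.fst) Primrec.snd)
    have h2 := (sigmaIn_isCertificate hS).preimage (f := fun p : Str × ℕ => (p.1.length, p.2))
      (Primrec.pair (Primrec.list_length.comp Primrec.fst) Primrec.snd)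
    exact ⟨_, (h1.inter h2).exists, rfl⟩
  have hmemI : ∀ X, X ∈ I ↔ ∃ m j, lam (tails S ∪ lexInit m j) < 2⁻¹ ∧ X ∈ lexInit m j := by
    intro X
    simp only [I, mem_openOf, Set.mem_ofPred_eq, length_initSeg, hcert, mem_lexInit, and_comm]
  refine ⟨tails S ∪ I, (ceOpen_tails hS).union hI, Set.subset_union_left, le_antisymm ?_ ?_⟩
  · let ι := {q : ℕ × ℕ // lam (tails S ∪ lexInit q.1 q.2) < 2⁻¹}
    have hI' : I = ⋃ q : ι, lexInit q.1.1 q.1.2 := by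
      ext X
      rw [hmemI, Set.mem_iUnion]
      constructor
      · rintro ⟨m, j, h1, h2⟩
        exact ⟨⟨(m, j), h1⟩, h2⟩
      · rintro ⟨⟨⟨m, j⟩, h1⟩, h2⟩
        exact ⟨m, j, h1, h2⟩
    rcases isEmpty_or_nonempty ι with hι | hι
    · have : I = ∅ := by rw [hI', Set.iUnion_of_empty]
      rw [this, Set.union_empty]
      exact lam_tails_le fun n => (hm n).le
    -- Initial segments are linearly ordered by inclusion, so the measure of the union is a supremum
    -- of values below `1/2`.
    · rw [hI', Set.union_iUnion, Directed.measure_iUnion]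
      · exact iSup_le fun q => q.2.le
      · intro p q
        rcases lexInit_total p.1.1 p.1.2 q.1.1 q.1.2 with h | h
        · exact ⟨q, Set.union_subset_union_right _ h, subset_rfl⟩
        · exact ⟨p, subset_rfl, Set.union_subset_union_right _ h⟩
  · by_contra! hlt
    obtain ⟨m, hmlt⟩ := ENNReal.exists_inv_two_pow_lt (tsub_pos_of_lt hlt).ne'
    -- With more than `2 ^ (-m)` of measure still missing, one more cylinder of length `m` can
    -- always be adjoined. All of them would then be, and the measure would be `1`.
    have hall : ∀ j, lexInit m j ⊆ tails S ∪ I := by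
      intro j
      induction j with
      | zero => simp [lexInit_zero]
      | succ j ih =>
        intro X hX
        refine Or.inr ((hmemI X).2 ⟨m, j + 1, ?_, hX⟩)
        have hsub : tails S ∪ lexInit m (j + 1) ⊆
            (tails S ∪ I) ∪ {X | binVal (initSeg X m) = j} := by
          rintro Y (hY | hY)
          · exact Or.inl (Or.inl hY)
          · rcases Nat.lt_succ_iff_lt_or_eq.1 hY with h | h
            · exact Or.inl (ih h)
            · exact Or.inr h
        refine (measure_mono hsub).trans_lt ((measure_union_le _ _).trans_lt ?_)
        refine (add_le_add_right (lam_binVal_eq_le m j) _).trans_lt ?_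
        rw [add_comm]
        exact lt_tsub_iff_right.1 hmlt
    have huniv := hall (2 ^ m)
    rw [lexInit_two_pow, Set.univ_subset_iff] at huniv
    rw [huniv, measure_univ] at hlt
    exact absurd hlt (by simp)

end

/-! ### The Schnorr case -/

theorem MLR_subset_SR_of_partialMLR_subset {Z A : Cantor}
    (h : PartialMLR Z ⊆ SR {oracle A}) : MLR ∅ ⊆ SR {oracle A} := by
  intro X hX V hV hXV
  obtain ⟨T, hT, hVT⟩ := hV.ce
  rw [ceIn_iff_sigmaIn] at hT
  obtain ⟨U, hU, hTU, hU2⟩ := exists_ceOpen_lam_eq_half hT fun n => by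
    simpa [hVT] using hV.measure_eq n
  obtain ⟨S, hS, hpf, rfl, Y, hY, hYS⟩ := exists_mem_partialMLR_iter Z hX hU
    (by simp [hU2]) fun k => hTU (shift_mem_tails (fun n => by
      simpa [hVT] using Set.mem_iInter.1 hXV n) k)
  exact h hY _ (isSchnorrTest_iter hS hpf hU2) (Set.mem_iInter.2 hYS)

/-! ### Functions computable in an oracle, through their graphs -/

section
variable {α β γ : Type} [Primcodable α] [Primcodable β] [Primcodable γ] {A : Cantor}

/-- The graph of `f` is c.e. in `A`. -/
def GraphIn (A : Cantor) (f : α → β) : Prop := SigmaIn A {p : α × β | p.2 = f p.1}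

theorem GraphIn.computableIn {f : α → β} (hf : GraphIn A f) : ComputableIn {oracle A} f :=
  computableIn_of_graph hf

theorem GraphIn.of_computableIn {f : α → β} (hf : ComputableIn {oracle A} f) : GraphIn A f := by
  have := SigmaIn.graph_of_recursiveIn hf
  simp only [Part.mem_some_iff] at this
  exact this

theorem GraphIn.of_primrec {f : α → β} (hf : Primrec f) : GraphIn A f :=
  SigmaIn.of_primrecPred (Primrec.eq.comp Primrec.snd (hf.comp Primrec.fst))

theorem GraphIn.comp {f : β → γ} {g : α → β} (hf : GraphIn A f) (hg : GraphIn A g) :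
    GraphIn A fun x => f (g x) := by
  have h1 : SigmaIn A {p : (α × γ) × β | p.2 = g p.1.1} :=
    SigmaIn.preimage (f := fun p : (α × γ) × β => (p.1.1, p.2)) hg
      (Primrec.pair (Primrec.fst.comp Primrec.fst) Primrec.snd)
  have h2 : SigmaIn A {p : (α × γ) × β | p.1.2 = f p.2} :=
    SigmaIn.preimage (f := fun p : (α × γ) × β => (p.2, p.1.2)) hf
      (Primrec.pair Primrec.snd (Primrec.snd.comp Primrec.fst))
  unfold GraphIn
  convert (h1.inter h2).exists using 1
  ext ⟨x, y⟩
  simp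

theorem GraphIn.pair {f : α → β} {g : α → γ} (hf : GraphIn A f) (hg : GraphIn A g) :
    GraphIn A fun x => (f x, g x) := by
  have h1 : SigmaIn A {p : α × β × γ | p.2.1 = f p.1} :=
    SigmaIn.preimage (f := fun p : α × β × γ => (p.1, p.2.1)) hf
      (Primrec.pair Primrec.fst (Primrec.fst.comp Primrec.snd))
  have h2 : SigmaIn A {p : α × β × γ | p.2.2 = g p.1} :=
    SigmaIn.preimage (f := fun p : α × β × γ => (p.1, p.2.2)) hg
      (Primrec.pair Primrec.fst (Primrec.snd.comp Primrec.snd))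
  unfold GraphIn
  convert (h1.inter h2) using 1
  ext ⟨x, y, z⟩
  simp

theorem GraphIn.sum_map {f : α × β → ℕ} (hf : GraphIn A f) :
    GraphIn A fun p : α × List β => (p.2.map fun c => f (p.1, c)).sum := by
  have h1 : SigmaIn A {q : ((α × List β) × ℕ) × List (β × ℕ) |
      q.1.1.2 = q.2.map Prod.fst ∧ q.1.2 = (q.2.map Prod.snd).sum} := by
    refine SigmaIn.of_primrecPred (PrimrecPred.and ?_ ?_)
    · exact Primrec.eq.comp (Primrec.snd.comp (Primrec.fst.comp Primrec.fst))
        (Primrec.list_map Primrec.snd (Primrec.fst.comp Primrec.snd))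
    · exact Primrec.eq.comp (Primrec.snd.comp Primrec.fst) (primrec_list_sum.comp
        (Primrec.list_map Primrec.snd (Primrec.snd.comp Primrec.snd)))
  have h2 : SigmaIn A {q : (β × ℕ) × α | q.1.2 = f (q.2, q.1.1)} :=
    SigmaIn.preimage (f := fun q : (β × ℕ) × α => ((q.2, q.1.1), q.1.2)) hf
      (Primrec.pair (Primrec.pair Primrec.snd (Primrec.fst.comp Primrec.fst))
        (Primrec.snd.comp Primrec.fst))
  have h3 := h2.forall_mem_list.preimage
    (f := fun q : ((α × List β) × ℕ) × List (β × ℕ) => (q.2, q.1.1.1))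
    (Primrec.pair Primrec.snd (Primrec.fst.comp (Primrec.fst.comp Primrec.fst)))
  unfold GraphIn
  convert (h1.inter h3).exists using 1
  ext ⟨⟨x, l⟩, y⟩
  simp only [Set.mem_ofPred_eq]
  constructor
  · rintro rfl
    refine ⟨l.map fun c => (c, f (x, c)), ⟨by rw [List.map_map]; exact (List.map_id l).symm,
      by simp [Function.comp_def]⟩, ?_⟩
    intro q hq
    obtain ⟨c, -, rfl⟩ := List.mem_map.1 hq
    rfl
  · rintro ⟨L, ⟨rfl, rfl⟩, h⟩
    rw [List.map_map]
    exact congrArg List.sum (List.map_congr_left h)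

/-- The witness is a transcript, a list of triples (state, input, next state). Whether successive
states match is primitive recursive (`check`); whether each triple obeys `f` is c.e. in `A`. -/
theorem GraphIn.foldl {f : β × γ → β} (hf : GraphIn A f) (b₀ : β) :
    GraphIn A fun l : List γ => l.foldl (fun b c => f (b, c)) b₀ := by
  classical
  let check : Option β → β × γ × β → Option β := fun o q => if o = some q.1 then some q.2.2 else none
  have hnone : ∀ T : List (β × γ × β), T.foldl check none = none := by
    intro T
    induction T with
    | nil => rfl
    | cons q T ih => simpa [check] using ih
  have hcheck : ∀ (T : List (β × γ × β)) (b y : β), (∀ q ∈ T, q.2.2 = f (q.1, q.2.1)) →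
      T.foldl check (some b) = some y →
      y = (T.map fun q => q.2.1).foldl (fun b c => f (b, c)) b := by
    intro T
    induction T with
    | nil => intro b y _ h; simpa [eq_comm] using h
    | cons q T ih =>
      intro b y hT h
      by_cases hb : b = q.1
      · subst hb
        simp only [List.foldl_cons, check, if_true] at h
        have := ih _ _ (fun q' hq' => hT q' (List.mem_cons_of_mem _ hq')) h
        rw [this, hT q List.mem_cons_self]
        rfl
      · have hb' : ¬ some b = some q.1 := by simpa using hb
        simp only [List.foldl_cons, check, if_neg hb'] at h
        exact absurd (h.symm.trans (hnone T)) (by simp)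
  have hex : ∀ (l : List γ) (b : β), ∃ T : List (β × γ × β), (∀ q ∈ T, q.2.2 = f (q.1, q.2.1)) ∧
      l = T.map (fun q => q.2.1) ∧
      T.foldl check (some b) = some (l.foldl (fun b c => f (b, c)) b) := by
    intro l
    induction l with
    | nil => exact fun b => ⟨[], by simp, rfl, rfl⟩
    | cons c l ih =>
      intro b
      obtain ⟨T, h1, h2, h3⟩ := ih (f (b, c))
      refine ⟨(b, c, f (b, c)) :: T, ?_, by simp [← h2], ?_⟩
      · intro q hq
        rcases List.mem_cons.1 hq with rfl | hq
        · rfl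
        · exact h1 q hq
      · simpa [check] using h3
  have hprim : SigmaIn A {q : (List γ × β) × List (β × γ × β) |
      q.1.1 = q.2.map (fun t => t.2.1) ∧ q.2.foldl check (some b₀) = some q.1.2} := by
    refine SigmaIn.of_primrecPred (PrimrecPred.and ?_ ?_)
    · exact Primrec.eq.comp (Primrec.fst.comp Primrec.fst)
        (Primrec.list_map Primrec.snd (Primrec.fst.comp (Primrec.snd.comp Primrec.snd)))
    · refine Primrec.eq.comp (Primrec.list_foldl (h := fun _ p => check p.1 p.2) Primrec.snd
        (Primrec.const (some b₀)) ?_) (Primrec.option_some.comp (Primrec.snd.comp Primrec.fst))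
      have h1 : Primrec fun z : ((List γ × β) × List (β × γ × β)) × Option β × β × γ × β =>
        z.2.2 := Primrec.snd.comp Primrec.snd
      exact Primrec.ite (Primrec.eq.comp (Primrec.fst.comp Primrec.snd)
        (Primrec.option_some.comp (Primrec.fst.comp h1)))
        (Primrec.option_some.comp (Primrec.snd.comp (Primrec.snd.comp h1))) (Primrec.const none)
  have h2 : SigmaIn A {q : (β × γ × β) × Unit | q.1.2.2 = f (q.1.1, q.1.2.1)} :=
    SigmaIn.preimage (f := fun q : (β × γ × β) × Unit => ((q.1.1, q.1.2.1), q.1.2.2)) hf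
      (Primrec.pair (Primrec.pair (Primrec.fst.comp Primrec.fst)
        (Primrec.fst.comp (Primrec.snd.comp Primrec.fst)))
        (Primrec.snd.comp (Primrec.snd.comp Primrec.fst)))
  have h3 := h2.forall_mem_list.preimage
    (f := fun q : (List γ × β) × List (β × γ × β) => (q.2, ()))
    (Primrec.pair Primrec.snd (Primrec.const ()))
  unfold GraphIn
  convert (hprim.inter h3).exists using 1
  ext ⟨l, y⟩
  simp only [Set.mem_ofPred_eq]
  constructor
  · rintro rfl
    obtain ⟨T, h1, h2, h3⟩ := hex l b₀
    exact ⟨T, ⟨h2, h3⟩, h1⟩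
  · rintro ⟨T, ⟨rfl, h2⟩, h3⟩
    exact hcheck T b₀ y h3 h2

end

/-! ### Natural number approximations of nonnegative computable functions -/

/-- `d` is computable relative to `A`, with dyadic approximations given by their numerators. -/
def DyadicIn (A : Cantor) (d : Str → ℝ) : Prop :=
  ∃ N : Str × ℕ → ℕ, GraphIn A N ∧ ∀ σ n, |d σ - (N (σ, n) : ℝ) / 2 ^ n| ≤ (1 / 2 : ℝ) ^ n

/-- The quotient is `2 ^ n * (a - b) / (c + 1)` rounded to a nearest integer, which costs at most
half a unit. If `a < b`, truncated subtraction gives `0`, which is at least as close to the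
nonnegative `x`. -/
theorem abs_sub_round_le {x : ℝ} (hx : 0 ≤ x) {a b c n : ℕ}
    (h : |x - ((a : ℝ) - b) / (c + 1)| ≤ (1 / 2 : ℝ) ^ (n + 1)) :
    |x - (((2 ^ (n + 1) * (a - b) + (c + 1)) / (2 * (c + 1)) : ℕ) : ℝ) / 2 ^ n| ≤
      (1 / 2 : ℝ) ^ n := by
  have hc : (0 : ℝ) < c + 1 := by positivity
  have h2 : (0 : ℝ) < 2 ^ n := by positivity
  have hpow : (1 / 2 : ℝ) ^ (n + 1) = (1 / 2 : ℝ) ^ n / 2 := by rw [pow_succ]; ring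
  have hinv : (1 / 2 : ℝ) ^ n * 2 ^ n = 1 := by rw [← mul_pow]; norm_num
  rcases le_or_gt b a with hab | hab
  · set N := (2 ^ (n + 1) * (a - b) + (c + 1)) / (2 * (c + 1)) with hN
    have h3 : N * (2 * (c + 1)) ≤ 2 ^ (n + 1) * (a - b) + (c + 1) := Nat.div_mul_le_self _ _
    have h4 : 2 ^ (n + 1) * (a - b) + (c + 1) < (N + 1) * (2 * (c + 1)) :=
      (Nat.lt_mul_div_succ _ (by omega)).trans_eq (mul_comm _ _)
    have h3' : (N : ℝ) * (2 * (c + 1)) ≤ 2 ^ (n + 1) * (a - b) + (c + 1) := by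
      have := (Nat.cast_le (α := ℝ)).2 h3
      push_cast [Nat.cast_sub hab] at this
      exact this
    have h4' : 2 ^ (n + 1) * ((a : ℝ) - b) + (c + 1) < (N + 1) * (2 * (c + 1)) := by
      have := (Nat.cast_lt (α := ℝ)).2 h4
      push_cast [Nat.cast_sub hab] at this
      exact this
    set q := ((a : ℝ) - b) / (c + 1) with hq
    have hqc : (a : ℝ) - b = q * (c + 1) := by rw [hq]; field_simp
    rw [hqc, pow_succ] at h3' h4'
    have h5 : (N : ℝ) ≤ 2 ^ n * q + 1 / 2 := by
      have : (N : ℝ) * (2 * (c + 1)) ≤ (2 ^ n * q + 1 / 2) * (2 * (c + 1)) := by nlinarith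
      exact le_of_mul_le_mul_right this (by positivity)
    have h6 : 2 ^ n * q - 1 / 2 ≤ (N : ℝ) := by
      have : (2 ^ n * q - 1 / 2) * (2 * (c + 1)) ≤ (N : ℝ) * (2 * (c + 1)) := by nlinarith
      exact le_of_mul_le_mul_right this (by positivity)
    have h7 : (N : ℝ) / 2 ^ n ≤ q + (1 / 2 : ℝ) ^ n / 2 := by
      rw [div_le_iff₀ h2]
      nlinarith
    have h8 : q - (1 / 2 : ℝ) ^ n / 2 ≤ (N : ℝ) / 2 ^ n := by
      rw [le_div_iff₀ h2]
      nlinarith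
    rw [hpow] at h
    rw [abs_le] at h ⊢
    constructor <;> linarith [h.1, h.2]
  · have h0 : a - b = 0 := by omega
    have h1 : (2 ^ (n + 1) * (a - b) + (c + 1)) / (2 * (c + 1)) = 0 := by
      rw [h0]
      exact Nat.div_eq_of_lt (by omega)
    rw [h1]
    have h3 : ((a : ℝ) - b) / (c + 1) ≤ 0 :=
      div_nonpos_of_nonpos_of_nonneg (by
        have : (a : ℝ) < b := by exact_mod_cast hab
        linarith) hc.le
    have h4 : (0 : ℝ) < (1 / 2 : ℝ) ^ n := by positivity
    rw [hpow] at h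
    rw [abs_le] at h ⊢
    norm_num at h ⊢
    constructor <;> linarith [h.1, h.2]

theorem RealComputableIn.dyadicIn {A : Cantor} {d : Str → ℝ} (hd : RealComputableIn {oracle A} d)
    (h0 : ∀ σ, 0 ≤ d σ) : DyadicIn A d := by
  obtain ⟨a, b, c, ha, hb, hc, h⟩ := hd
  have hsucc : GraphIn A fun p : Str × ℕ => (p.1, p.2 + 1) :=
    GraphIn.of_primrec (Primrec.pair Primrec.fst (Primrec.succ.comp Primrec.snd))
  have hround : GraphIn A fun p : (ℕ × ℕ × ℕ) × ℕ =>
      (2 ^ (p.2 + 1) * (p.1.1 - p.1.2.1) + (p.1.2.2 + 1)) / (2 * (p.1.2.2 + 1)) := by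
    have hc : Primrec fun p : (ℕ × ℕ × ℕ) × ℕ => p.1.2.2 + 1 :=
      Primrec.succ.comp (Primrec.snd.comp (Primrec.snd.comp Primrec.fst))
    refine GraphIn.of_primrec (Primrec.nat_div.comp (Primrec.nat_add.comp (Primrec.nat_mul.comp
      (primrec_two_pow.comp (Primrec.succ.comp Primrec.snd)) (Primrec.nat_sub.comp
      (Primrec.fst.comp Primrec.fst) (Primrec.fst.comp (Primrec.snd.comp Primrec.fst)))) hc)
      (Primrec.nat_mul.comp (Primrec.const 2) hc))
  refine ⟨_, hround.comp (GraphIn.pair (((GraphIn.of_computableIn ha).comp hsucc).pair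
    (((GraphIn.of_computableIn hb).comp hsucc).pair ((GraphIn.of_computableIn hc).comp hsucc)))
    (GraphIn.of_primrec Primrec.snd)), fun σ n => ?_⟩
  exact abs_sub_round_le (h0 σ) (h σ (n + 1))

/-! ### Success of martingales -/

theorem Succeeds.exists_lt {d : Str → ℝ} {X : Cantor} (h : Succeeds d X) (B : ℝ) (k : ℕ) :
    ∃ n, B < d (initSeg X (k + n)) := by
  by_contra! hc
  have : limsup (fun n => ((d (initSeg X n) : ℝ) : EReal)) atTop ≤ (B : EReal) := by
    refine limsup_le_of_le (h := ?_)
    filter_upwards [eventually_ge_atTop k] with n hn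
    obtain ⟨m, rfl⟩ := Nat.exists_eq_add_of_le hn
    exact_mod_cast hc m
  rw [h] at this
  exact absurd this (by simp)

theorem succeeds_of_unbounded {d : Str → ℝ} {X : Cantor}
    (h : ∀ B : ℝ, ∃ n, B < d (initSeg X n)) : Succeeds d X := by
  by_contra hne
  obtain ⟨B, hB, -⟩ := EReal.lt_iff_exists_real_btwn.1 (lt_top_iff_ne_top.2 hne)
  obtain ⟨K, hK⟩ := eventually_atTop.1 (eventually_lt_of_limsup_lt hB)
  -- The sum dominates the finitely many values before `K`, on which the limsup gives no
  -- information.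
  obtain ⟨n, hn⟩ := h (|B| + ∑ i ∈ Finset.range K, |d (initSeg X i)|)
  have hs : 0 ≤ ∑ i ∈ Finset.range K, |d (initSeg X i)| := Finset.sum_nonneg fun _ _ => abs_nonneg _
  rcases le_or_gt K n with hKn | hKn
  · have h1 : d (initSeg X n) < B := by exact_mod_cast hK n hKn
    linarith [le_abs_self B]
  · have h1 : |d (initSeg X n)| ≤ ∑ i ∈ Finset.range K, |d (initSeg X i)| :=
      Finset.single_le_sum (f := fun i => |d (initSeg X i)|) (fun _ _ => abs_nonneg _)
        (Finset.mem_range.2 hKn)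
    linarith [le_abs_self (d (initSeg X n)), abs_nonneg B]

theorem IsMartingale.le_two_pow_mul {d : Str → ℝ} (hd : IsMartingale d) (σ : Str) :
    d σ ≤ 2 ^ σ.length * d [] := by
  induction σ using List.reverseRecOn with
  | nil => simp
  | append_singleton σ b ih =>
    have h1 := hd.fair σ
    have h2 := hd.nonneg (σ ++ [false])
    have h3 := hd.nonneg (σ ++ [true])
    rw [List.length_append, List.length_singleton, pow_succ]
    cases b <;> linarith

/-! ### Averaging a martingale over all starting points -/

/-- The weighted sum of the martingales obtained from `d` by starting at the various strings. -/
def mixture (d : Str → ℝ) (τ : Str) : ℝ := ∑' i, (1 / 4 : ℝ) ^ i * d (enumStr i ++ τ)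

section
variable {d : Str → ℝ}

/-- A martingale at most doubles with each bit, so `enumStr i` contributes a factor of at most `2 ^
i`; the weight `4 ^ (-i)` leaves a geometric series. -/
theorem mixture_term_le (hd : IsMartingale d) (τ : Str) (i : ℕ) :
    (1 / 4 : ℝ) ^ i * d (enumStr i ++ τ) ≤ (1 / 2 : ℝ) ^ i * (2 ^ τ.length * d []) := by
  have h1 := hd.le_two_pow_mul (enumStr i ++ τ)
  have h2 : (2 : ℝ) ^ (enumStr i ++ τ).length ≤ 2 ^ i * 2 ^ τ.length := by
    rw [List.length_append, pow_add]
    gcongr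
    · norm_num
    · exact length_enumStr_le i
  have h3 : (1 / 4 : ℝ) ^ i * 2 ^ i = (1 / 2) ^ i := by rw [← mul_pow]; norm_num
  calc (1 / 4 : ℝ) ^ i * d (enumStr i ++ τ)
      ≤ (1 / 4 : ℝ) ^ i * (2 ^ i * 2 ^ τ.length * d []) := by
        gcongr
        exact h1.trans (mul_le_mul_of_nonneg_right h2 (hd.nonneg []))
    _ = ((1 / 4 : ℝ) ^ i * 2 ^ i) * (2 ^ τ.length * d []) := by ring
    _ = _ := by rw [h3]

theorem mixture_term_nonneg (hd : IsMartingale d) (τ : Str) (i : ℕ) :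
    0 ≤ (1 / 4 : ℝ) ^ i * d (enumStr i ++ τ) :=
  mul_nonneg (by positivity) (hd.nonneg _)

theorem summable_mixture (hd : IsMartingale d) (τ : Str) :
    Summable fun i => (1 / 4 : ℝ) ^ i * d (enumStr i ++ τ) :=
  Summable.of_nonneg_of_le (mixture_term_nonneg hd τ) (mixture_term_le hd τ)
    (summable_geometric_two.mul_right _)

theorem isMartingale_mixture (hd : IsMartingale d) : IsMartingale (mixture d) where
  nonneg σ := tsum_nonneg (mixture_term_nonneg hd σ)
  fair σ := by
    rw [mixture, mixture, mixture, ← (summable_mixture hd _).tsum_add (summable_mixture hd _),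
      ← tsum_div_const]
    refine tsum_congr fun i => ?_
    rw [hd.fair (enumStr i ++ σ), ← List.append_assoc, ← List.append_assoc]
    ring

/-- The summand that starts at `initSeg X k` plays `d` along `X` itself, up to a constant factor. -/
theorem mixture_unbounded_shift (hd : IsMartingale d) {X : Cantor} (hX : Succeeds d X) (k : ℕ)
    (B : ℝ) : ∃ n, B < mixture d (initSeg (shift k X) n) := by
  set i := Encodable.encode (initSeg X k) with hi
  obtain ⟨n, hn⟩ := hX.exists_lt (4 ^ i * B) k
  refine ⟨n, ?_⟩
  have h1 := (summable_mixture hd (initSeg (shift k X) n)).le_tsum i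
    fun j _ => mixture_term_nonneg hd _ j
  refine lt_of_lt_of_le ?_ h1
  rw [hi, enumStr_encode, ← initSeg_add, ← hi]
  have h4 : (1 / 4 : ℝ) ^ i * 4 ^ i = 1 := by rw [← mul_pow]; norm_num
  calc B = (1 / 4 : ℝ) ^ i * (4 ^ i * B) := by rw [← mul_assoc, h4, one_mul]
    _ < _ := by gcongr

theorem abs_mixture_sub_le (hd : IsMartingale d) {N : Str × ℕ → ℕ}
    (hN : ∀ σ n, |d σ - (N (σ, n) : ℝ) / 2 ^ n| ≤ (1 / 2 : ℝ) ^ n) {R : ℕ} (hR : d [] ≤ 2 ^ R)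
    (τ : Str) (n : ℕ) :
    |mixture d τ - ∑ i ∈ Finset.range (τ.length + R + n + 2),
      (1 / 4 : ℝ) ^ i * ((N (enumStr i ++ τ, n + 2) : ℝ) / 2 ^ (n + 2))| ≤ (1 / 2 : ℝ) ^ n := by
  -- The cutoff makes the discarded tail at most `2 ^ (-n) / 2`. Precision `n + 2` in the retained
  -- terms keeps their total error within the same bound.
  set K := τ.length + R + n + 2 with hK
  have hsplit := (summable_mixture hd τ).sum_add_tsum_nat_add K
  have hn2 : (1 / 2 : ℝ) ^ (n + 2) = (1 / 2 : ℝ) ^ n / 4 := by rw [pow_add]; ring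
  have htail0 : 0 ≤ ∑' i, (1 / 4 : ℝ) ^ (i + K) * d (enumStr (i + K) ++ τ) :=
    tsum_nonneg fun i => mixture_term_nonneg hd τ (i + K)
  have htail : ∑' i, (1 / 4 : ℝ) ^ (i + K) * d (enumStr (i + K) ++ τ) ≤ (1 / 2 : ℝ) ^ n / 2 := by
    have hpow : (1 / 2 : ℝ) ^ K * (2 ^ τ.length * 2 ^ R) = (1 / 2 : ℝ) ^ (n + 2) := by
      have e : ∀ m : ℕ, (1 / 2 : ℝ) ^ m * 2 ^ m = 1 := fun m => by rw [← mul_pow]; norm_num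
      calc (1 / 2 : ℝ) ^ K * (2 ^ τ.length * 2 ^ R)
          = ((1 / 2 : ℝ) ^ τ.length * 2 ^ τ.length) * ((1 / 2 : ℝ) ^ R * 2 ^ R) *
            (1 / 2 : ℝ) ^ (n + 2) := by rw [hK]; ring
        _ = _ := by rw [e, e]; ring
    have hb : ∀ i, (1 / 4 : ℝ) ^ (i + K) * d (enumStr (i + K) ++ τ) ≤
        (1 / 2 : ℝ) ^ i * (1 / 2 : ℝ) ^ (n + 2) := by
      intro i
      refine (mixture_term_le hd τ (i + K)).trans ?_
      rw [← hpow, pow_add, mul_assoc]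
      gcongr
    calc ∑' i, (1 / 4 : ℝ) ^ (i + K) * d (enumStr (i + K) ++ τ)
        ≤ ∑' i, (1 / 2 : ℝ) ^ i * (1 / 2 : ℝ) ^ (n + 2) :=
          ((summable_nat_add_iff K).2 (summable_mixture hd τ)).tsum_le_tsum hb
            (summable_geometric_two.mul_right _)
      _ = (1 / 2 : ℝ) ^ n / 2 := by rw [tsum_mul_right, tsum_geometric_two, hn2]; ring
  have hhead : |∑ i ∈ Finset.range K, (1 / 4 : ℝ) ^ i * d (enumStr i ++ τ) -
      ∑ i ∈ Finset.range K, (1 / 4 : ℝ) ^ i * ((N (enumStr i ++ τ, n + 2) : ℝ) / 2 ^ (n + 2))| ≤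
      (1 / 2 : ℝ) ^ n / 2 := by
    rw [← Finset.sum_sub_distrib]
    refine (Finset.abs_sum_le_sum_abs _ _).trans ?_
    calc _ ≤ ∑ i ∈ Finset.range K, (1 / 2 : ℝ) ^ i * (1 / 2 : ℝ) ^ (n + 2) := by
          refine Finset.sum_le_sum fun i _ => ?_
          rw [← mul_sub, abs_mul, abs_of_nonneg (by positivity : (0 : ℝ) ≤ (1 / 4) ^ i)]
          gcongr
          · norm_num
          · exact hN _ _
      _ ≤ 2 * (1 / 2 : ℝ) ^ (n + 2) := by
          rw [← Finset.sum_mul]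
          gcongr
          exact (summable_geometric_two.sum_le_tsum _ fun i _ => by positivity).trans_eq
            tsum_geometric_two
      _ = _ := by rw [hn2]; ring
  rw [mixture, ← hsplit]
  rw [abs_le] at hhead ⊢
  constructor <;> linarith [hhead.1, hhead.2]

theorem graphIn_mixture_numerator {A : Cantor} {N : Str × ℕ → ℕ} (hN : GraphIn A N)
    {K : Str × ℕ → ℕ} (hK : Primrec K) :
    GraphIn A fun p : Str × ℕ => ((List.range (K p)).map fun i =>
      2 ^ (2 * (K p - i)) * N (enumStr i ++ p.1, p.2 + 2)).sum := by
  have hterm : GraphIn A fun q : (Str × ℕ) × ℕ =>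
      2 ^ (2 * (K q.1 - q.2)) * N (enumStr q.2 ++ q.1.1, q.1.2 + 2) := by
    have h1 : GraphIn A fun q : (Str × ℕ) × ℕ => N (enumStr q.2 ++ q.1.1, q.1.2 + 2) :=
      hN.comp (GraphIn.of_primrec (Primrec.pair (Primrec.list_append.comp
        (primrec_enumStr.comp Primrec.snd) (Primrec.fst.comp Primrec.fst))
        (Primrec.nat_add.comp (Primrec.snd.comp Primrec.fst) (Primrec.const 2))))
    have h2 : GraphIn A fun q : (Str × ℕ) × ℕ => 2 ^ (2 * (K q.1 - q.2)) :=
      GraphIn.of_primrec (primrec_two_pow.comp (Primrec.nat_mul.comp (Primrec.const 2)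
        (Primrec.nat_sub.comp (hK.comp Primrec.fst) Primrec.snd)))
    exact (GraphIn.of_primrec (f := fun p : ℕ × ℕ => p.1 * p.2) Primrec.nat_mul).comp (h2.pair h1)
  exact hterm.sum_map.comp (GraphIn.of_primrec (f := fun p : Str × ℕ => (p, List.range (K p)))
    (Primrec.pair Primrec.id (Primrec.list_range.comp hK)))

theorem realComputableIn_mixture {A : Cantor} (hd : IsMartingale d) (h : DyadicIn A d) :
    RealComputableIn {oracle A} (mixture d) := by
  obtain ⟨N, hNg, hN⟩ := h
  obtain ⟨R, hR⟩ := pow_unbounded_of_one_lt (d []) (one_lt_two)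
  obtain ⟨K, hKdef⟩ : ∃ K : Str × ℕ → ℕ, K = fun p => p.1.length + R + p.2 + 2 := ⟨_, rfl⟩
  have hK : Primrec K := by
    rw [hKdef]
    exact Primrec.nat_add.comp (Primrec.nat_add.comp (Primrec.nat_add.comp
      (Primrec.list_length.comp Primrec.fst) (Primrec.const R)) Primrec.snd) (Primrec.const 2)
  -- The common denominator is `4 ^ K * 2 ^ (n + 2)`, less the one that `RealComputableIn` adds.
  have hc : Primrec fun p : Str × ℕ => 2 ^ (2 * K p) * 2 ^ (p.2 + 2) - 1 :=
    Primrec.nat_sub.comp (Primrec.nat_mul.comp (primrec_two_pow.comp (Primrec.nat_mul.comp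
      (Primrec.const 2) hK)) (primrec_two_pow.comp (Primrec.nat_add.comp Primrec.snd
      (Primrec.const 2)))) (Primrec.const 1)
  refine ⟨_, fun _ => 0, _, (graphIn_mixture_numerator hNg hK).computableIn, ComputableIn.const 0,
    hc.computableIn, fun σ n => ?_⟩
  refine le_of_eq_of_le ?_ (abs_mixture_sub_le hd hN hR.le σ n)
  have hKσ : σ.length + R + n + 2 = K (σ, n) := by rw [hKdef]
  rw [hKσ]
  generalize K (σ, n) = k
  congr 2
  have hpos : 1 ≤ 2 ^ (2 * k) * 2 ^ (n + 2) := Nat.one_le_iff_ne_zero.2 (by positivity)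
  rw [Nat.cast_sub hpos, Nat.cast_list_sum, List.map_map, ← List.sum_toFinset _ List.nodup_range,
    List.toFinset_range]
  push_cast
  rw [sub_zero, sub_add_cancel, Finset.sum_div]
  refine Finset.sum_congr rfl fun i hi => ?_
  have hik : i ≤ k := (Finset.mem_range.1 hi).le
  have e : (2 : ℝ) ^ (2 * k) = 2 ^ (2 * (k - i)) * 4 ^ i := by
    rw [show (4 : ℝ) = 2 ^ 2 by norm_num, ← pow_mul, ← pow_add]
    congr 1
    omega
  simp only [Function.comp_apply]
  push_cast
  rw [e, one_div, inv_pow]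
  field_simp

end

/-! ### Restarting a martingale -/

/-- One step of cutting a sequence into blocks: the current block is completed once `t` exceeds
`B` on it. -/
def cutStep (t : Str → ℕ) (B : ℕ) (s : List Str × Str) (b : Bool) : List Str × Str :=
  if B < t (s.2 ++ [b]) then (s.1 ++ [s.2 ++ [b]], []) else (s.1, s.2 ++ [b])

/-- The completed blocks of a string, and the current block. -/
def cut (t : Str → ℕ) (B : ℕ) (σ : Str) : List Str × Str := σ.foldl (cutStep t B) ([], [])

/-- The minimal strings on which `t` exceeds `B`. -/
def blockSet (t : Str → ℕ) (B : ℕ) : Set Str := minimals {σ | B < t σ}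

section
variable {t : Str → ℕ} {B : ℕ}

theorem cut_concat (σ : Str) (b : Bool) : cut t B (σ ++ [b]) = cutStep t B (cut t B σ) b := by
  simp [cut]

theorem length_cut_le (σ : Str) : (cut t B σ).1.length ≤ σ.length := by
  induction σ using List.reverseRecOn with
  | nil => simp [cut]
  | append_singleton σ b ih =>
    rw [cut_concat, cutStep]
    split_ifs <;> simp <;> omega

theorem lt_of_mem_cut (σ : Str) : ∀ τ ∈ (cut t B σ).1, B < t τ := by
  induction σ using List.reverseRecOn with
  | nil => simp [cut]
  | append_singleton σ b ih =>
    rw [cut_concat, cutStep]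
    split_ifs with h
    · intro τ hτ
      rcases List.mem_append.1 hτ with hτ | hτ
      · exact ih τ hτ
      · rw [List.mem_singleton.1 hτ]
        exact h
    · exact ih

theorem foldl_cutStep_of_not_lt (l : List Str) {c : Str} (h : ∀ ρ, ρ <+: c → ρ ≠ [] → ¬ B < t ρ) :
    c.foldl (cutStep t B) (l, []) = (l, c) := by
  induction c using List.reverseRecOn with
  | nil => rfl
  | append_singleton c b ih =>
    rw [List.foldl_append, ih fun ρ hρ => h ρ (hρ.trans (List.prefix_append _ _))]
    simp [cutStep, if_neg (h (c ++ [b]) List.prefix_rfl (by simp))]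

theorem foldl_cutStep_of_mem (h0 : ¬ B < t []) (l : List Str) {τ : Str} (hτ : τ ∈ blockSet t B) :
    τ.foldl (cutStep t B) (l, []) = (l ++ [τ], []) := by
  rcases List.eq_nil_or_concat τ with rfl | ⟨c, b, rfl⟩
  · exact absurd hτ.1 h0
  · rw [List.concat_eq_append] at hτ ⊢
    rw [List.foldl_append, foldl_cutStep_of_not_lt]
    · have : B < t (c ++ [b]) := hτ.1
      simp [cutStep, this]
    · intro ρ hρ _ hlt
      have := hτ.2 ρ (hρ.trans (List.prefix_append _ _)) hlt
      have h2 := hρ.length_le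
      rw [this] at h2
      simp at h2

/-- Minimality ensures that a block is cut at its end and not earlier, so the decomposition is
recovered. -/
theorem cut_flatten (h0 : ¬ B < t []) {l : List Str} (hl : ∀ τ ∈ l, τ ∈ blockSet t B) :
    cut t B l.flatten = (l, []) := by
  induction l using List.reverseRecOn with
  | nil => rfl
  | append_singleton l τ ih =>
    have h1 : cut t B l.flatten = (l, []) := ih fun ρ hρ => hl ρ (List.mem_append_left _ hρ)
    rw [cut] at h1 ⊢
    rw [List.flatten_append, List.foldl_append, h1, List.flatten_singleton]
    exact foldl_cutStep_of_mem h0 l (hl τ (by simp))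

theorem graphIn_cut {A : Cantor} (ht : GraphIn A t) : GraphIn A (cut t B) := by
  have h1 : GraphIn A fun p : (List Str × Str) × Bool => t (p.1.2 ++ [p.2]) :=
    ht.comp (GraphIn.of_primrec (f := fun p : (List Str × Str) × Bool => p.1.2 ++ [p.2])
      (Primrec.list_concat.comp (Primrec.snd.comp Primrec.fst) Primrec.snd))
  have h2 : Primrec fun q : ((List Str × Str) × Bool) × ℕ =>
      if B < q.2 then (q.1.1.1 ++ [q.1.1.2 ++ [q.1.2]], ([] : Str))
      else (q.1.1.1, q.1.1.2 ++ [q.1.2]) := by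
    have hc : Primrec fun q : ((List Str × Str) × Bool) × ℕ => q.1.1.2 ++ [q.1.2] :=
      Primrec.list_concat.comp (Primrec.snd.comp (Primrec.fst.comp Primrec.fst))
        (Primrec.snd.comp Primrec.fst)
    have hl : Primrec fun q : ((List Str × Str) × Bool) × ℕ => q.1.1.1 :=
      Primrec.fst.comp (Primrec.fst.comp Primrec.fst)
    exact Primrec.ite (Primrec.nat_lt.comp (Primrec.const B) Primrec.snd)
      (Primrec.pair (Primrec.list_concat.comp hl hc) (Primrec.const [])) (Primrec.pair hl hc)
  have h3 : GraphIn A fun p : (List Str × Str) × Bool => cutStep t B p.1 p.2 :=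
    (GraphIn.of_primrec h2).comp ((GraphIn.of_primrec Primrec.id).pair h1)
  exact h3.foldl ([], [])

/-- The martingale `D`, restarted with its initial capital each time a block is completed; what
was won in earlier blocks is saved. -/
def restart (D : Str → ℝ) (t : Str → ℕ) (B : ℕ) (σ : Str) : ℝ :=
  ((cut t B σ).1.map fun τ => D τ - D []).sum + D (cut t B σ).2

/-- Completing a block `τ` only splits `D τ` into the profit `D τ - D []` and the new capital `D
[]`. One formula covers both cases, and fairness reduces to that of `D`. -/
theorem restart_concat (D : Str → ℝ) (σ : Str) (b : Bool) : restart D t B (σ ++ [b]) =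
    ((cut t B σ).1.map fun τ => D τ - D []).sum + D ((cut t B σ).2 ++ [b]) := by
  rw [restart, cut_concat, cutStep]
  split_ifs
  · simp [add_assoc]
  · rfl

theorem isMartingale_restart {D : Str → ℝ} (hD : IsMartingale D)
    (ht : ∀ τ, B < t τ → D [] ≤ D τ) : IsMartingale (restart D t B) where
  nonneg σ := by
    refine add_nonneg (List.sum_nonneg fun x hx => ?_) (hD.nonneg _)
    obtain ⟨τ, hτ, rfl⟩ := List.mem_map.1 hx
    exact sub_nonneg.2 (ht τ (lt_of_mem_cut σ τ hτ))
  fair σ := by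
    rw [restart_concat, restart_concat, restart, hD.fair (cut t B σ).2]
    ring

theorem realComputableIn_restart {A : Cantor} {D : Str → ℝ} {N : Str × ℕ → ℕ} (hN : GraphIn A N)
    (hND : ∀ σ n, |D σ - (N (σ, n) : ℝ) / 2 ^ n| ≤ (1 / 2 : ℝ) ^ n) (ht : GraphIn A t) :
    RealComputableIn {oracle A} (restart D t B) := by
  -- At most `σ.length` blocks are completed and each contributes two errors, with one more from the
  -- current block. The extra precision absorbs the factor `2 * l.length + 1`.
  have hp : Primrec fun q : Str × ℕ => q.2 + (2 * q.1.length + 1) :=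
    Primrec.nat_add.comp Primrec.snd (Primrec.succ.comp (Primrec.nat_mul.comp (Primrec.const 2)
      (Primrec.list_length.comp Primrec.fst)))
  have hcut : GraphIn A fun q : Str × ℕ => cut t B q.1 :=
    (graphIn_cut ht).comp (GraphIn.of_primrec Primrec.fst)
  have hcut1 : GraphIn A fun q : Str × ℕ => (cut t B q.1).1 :=
    (GraphIn.of_primrec Primrec.fst).comp hcut
  have hcut2 : GraphIn A fun q : Str × ℕ => (cut t B q.1).2 :=
    (GraphIn.of_primrec Primrec.snd).comp hcut
  have hswap : GraphIn A fun q : ℕ × Str => N (q.2, q.1) :=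
    hN.comp (GraphIn.of_primrec (Primrec.pair Primrec.snd Primrec.fst))
  have hsum : GraphIn A fun q : Str × ℕ => ((cut t B q.1).1.map fun τ =>
      N (τ, q.2 + (2 * q.1.length + 1))).sum :=
    hswap.sum_map.comp ((GraphIn.of_primrec hp).pair hcut1)
  have hlast : GraphIn A fun q : Str × ℕ => N ((cut t B q.1).2, q.2 + (2 * q.1.length + 1)) :=
    hN.comp (hcut2.pair (GraphIn.of_primrec hp))
  have hnil : GraphIn A fun q : Str × ℕ => N ([], q.2 + (2 * q.1.length + 1)) :=
    hN.comp ((GraphIn.of_primrec (Primrec.const [])).pair (GraphIn.of_primrec hp))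
  have ha : GraphIn A fun q : Str × ℕ => ((cut t B q.1).1.map fun τ =>
      N (τ, q.2 + (2 * q.1.length + 1))).sum + N ((cut t B q.1).2, q.2 + (2 * q.1.length + 1)) :=
    (GraphIn.of_primrec (f := fun p : ℕ × ℕ => p.1 + p.2) Primrec.nat_add).comp (hsum.pair hlast)
  have hb : GraphIn A fun q : Str × ℕ => (cut t B q.1).1.length *
      N ([], q.2 + (2 * q.1.length + 1)) :=
    (GraphIn.of_primrec (f := fun p : ℕ × ℕ => p.1 * p.2) Primrec.nat_mul).comp
      (((GraphIn.of_primrec Primrec.list_length).comp hcut1).pair hnil)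
  have hc : Primrec fun q : Str × ℕ => 2 ^ (q.2 + (2 * q.1.length + 1)) - 1 :=
    Primrec.nat_sub.comp (primrec_two_pow.comp hp) (Primrec.const 1)
  refine ⟨_, _, _, ha.computableIn, hb.computableIn, hc.computableIn, fun σ n => ?_⟩
  simp only [restart]
  have hlen := length_cut_le (t := t) (B := B) σ
  generalize cut t B σ = s at hlen
  obtain ⟨l, c⟩ := s
  simp only at hlen ⊢
  have hpe : (1 / 2 : ℝ) ^ (n + (2 * σ.length + 1)) * (2 * l.length + 1) ≤ (1 / 2 : ℝ) ^ n := by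
    have h1 : (2 * l.length + 1 : ℝ) ≤ 2 ^ (2 * σ.length + 1) := by
      have h2 : 2 * l.length + 1 ≤ 2 ^ (2 * σ.length + 1) :=
        (show 2 * l.length + 1 ≤ 2 * σ.length + 1 by omega).trans Nat.lt_two_pow_self.le
      exact_mod_cast h2
    calc (1 / 2 : ℝ) ^ (n + (2 * σ.length + 1)) * (2 * l.length + 1)
        ≤ (1 / 2 : ℝ) ^ (n + (2 * σ.length + 1)) * 2 ^ (2 * σ.length + 1) := by gcongr
      _ = (1 / 2 : ℝ) ^ n * ((1 / 2 : ℝ) ^ (2 * σ.length + 1) * 2 ^ (2 * σ.length + 1)) := by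
          rw [pow_add]; ring
      _ = _ := by rw [← mul_pow]; norm_num
  refine le_trans ?_ hpe
  generalize n + (2 * σ.length + 1) = p
  have hpos : 1 ≤ 2 ^ p := Nat.one_le_two_pow
  simp only [Nat.cast_sub hpos, Nat.cast_add, Nat.cast_mul, Nat.cast_pow, Nat.cast_ofNat,
    Nat.cast_one, sub_add_cancel]
  have hl : |(l.map fun τ => D τ - D []).sum - (((l.map fun τ => N (τ, p)).sum : ℕ) -
      (l.length : ℝ) * N ([], p)) / 2 ^ p| ≤ (1 / 2 : ℝ) ^ p * (2 * l.length) := by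
    clear hpe hlen
    induction l with
    | nil => simp
    | cons τ l ih =>
      have h1 := hND τ p
      have h2 := hND [] p
      simp only [List.map_cons, List.sum_cons, List.length_cons, Nat.cast_add, Nat.cast_one]
      have e : ((N (τ, p) : ℝ) + ((l.map fun τ => N (τ, p)).sum : ℕ) -
          ((l.length : ℝ) + 1) * N ([], p)) / 2 ^ p = N (τ, p) / 2 ^ p - N ([], p) / 2 ^ p +
          (((l.map fun τ => N (τ, p)).sum : ℕ) - (l.length : ℝ) * N ([], p)) / 2 ^ p := by ring
      rw [e]
      rw [abs_le] at h1 h2 ih ⊢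
      constructor <;> linarith [h1.1, h1.2, h2.1, h2.2, ih.1, ih.2]
  have hc' := hND c p
  have e : ((((l.map fun τ => N (τ, p)).sum : ℕ) : ℝ) + N (c, p) - l.length * N ([], p)) / 2 ^ p =
      (((l.map fun τ => N (τ, p)).sum : ℕ) - (l.length : ℝ) * N ([], p)) / 2 ^ p +
      N (c, p) / 2 ^ p := by ring
  rw [e]
  rw [abs_le] at hl hc' ⊢
  constructor <;> linarith [hl.1, hl.2, hc'.1, hc'.2]

theorem succeeds_restart {D : Str → ℝ} (hD : IsMartingale D) (h0 : ¬ B < t [])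
    (ht : ∀ τ, B < t τ → D [] + 1 ≤ D τ) {Y : Cantor} (hY : ∀ n, Y ∈ iter (blockSet t B) n) :
    Succeeds (restart D t B) Y := by
  refine succeeds_of_unbounded fun b => ?_
  obtain ⟨n, hn⟩ := exists_nat_gt b
  obtain ⟨l, hl, hlS, hYl⟩ := mem_iter_iff.1 (hY n)
  refine ⟨l.flatten.length, hn.trans_le ?_⟩
  rw [hYl, restart, cut_flatten h0 hlS]
  have h1 : (l.length : ℝ) * 1 ≤ (l.map fun τ => D τ - D []).sum := by
    have := List.card_nsmul_le_sum (l.map fun τ => D τ - D []) 1 (by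
      intro x hx
      obtain ⟨τ, hτ, rfl⟩ := List.mem_map.1 hx
      linarith [ht τ (hlS τ hτ).1])
    simpa using this
  rw [hl] at h1
  linarith [hD.nonneg []]

end

/-! ### The computable randomness case -/

theorem MLR_subset_CR_of_partialMLR_subset {Z A : Cantor}
    (h : PartialMLR Z ⊆ CR {oracle A}) : MLR ∅ ⊆ CR {oracle A} := by
  intro X hX d hd hdc hdX
  have hD := isMartingale_mixture hd
  obtain ⟨N, hN, hND⟩ := (realComputableIn_mixture hd (hdc.dyadicIn hd.nonneg)).dyadicIn hD.nonneg
  set D := mixture d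
  -- Comparing `D` with a real bound is not decidable, so blocks are cut by the natural number `t`,
  -- which is within `1` of `D`. With `B ≥ D [] + 1`, the empty string is not a block, and `t τ > B`
  -- yields a profit of at least `1`.
  let t : Str → ℕ := fun τ => N (τ, 0)
  have ht : GraphIn A t :=
    hN.comp (GraphIn.of_primrec (Primrec.pair Primrec.id (Primrec.const 0)))
  have htD : ∀ τ, |D τ - t τ| ≤ 1 := fun τ => by simpa using hND τ 0
  obtain ⟨B, hB⟩ := exists_nat_ge (D [] + 1)
  have h0 : ¬ B < t [] := by
    intro hlt
    have h1 : (B : ℝ) < t [] := by exact_mod_cast hlt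
    linarith [(abs_le.1 (htD [])).1]
  have h1 : ∀ τ, B < t τ → D [] + 1 ≤ D τ := by
    intro τ hlt
    have h1 : (B : ℝ) + 1 ≤ t τ := by exact_mod_cast hlt
    linarith [(abs_le.1 (htD τ)).1]
  have htail : ∀ k, shift k X ∈ openOf (blockSet t B) := by
    intro k
    rw [blockSet, openOf_minimals, mem_openOf]
    obtain ⟨n, hn⟩ := mixture_unbounded_shift hd hdX k (B + 1)
    refine ⟨n, ?_⟩
    have h2 : (B : ℝ) < t (initSeg (shift k X) n) := by
      linarith [(abs_le.1 (htD (initSeg (shift k X) n))).2]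
    exact_mod_cast h2
  obtain ⟨Y, hY, hYS⟩ := exists_mem_partialMLR Z (S := blockSet t B) (fun h => h0 h.1)
    fun M hM hlt => exists_lam_app_preimage_lt_one hX htail hM hlt
  exact h hY (restart D t B) (isMartingale_restart hD fun τ hτ => by linarith [h1 τ hτ])
    (realComputableIn_restart hN hND ht) (succeeds_restart hD h0 h1 hYS)

end Randomness
end

theorem mainTheorem9 (Z : Randomness.Cantor) :
    Randomness.LowPair (Randomness.PartialMLR Z) Randomness.MLR = Randomness.Low Randomness.MLR ∧
    Randomness.LowPair (Randomness.PartialMLR Z) Randomness.CR =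
      Randomness.LowPair (Randomness.MLR ∅) Randomness.CR ∧
    Randomness.LowPair (Randomness.PartialMLR Z) Randomness.SR =
      Randomness.LowPair (Randomness.MLR ∅) Randomness.SR := by
  open Randomness in
  refine ⟨Set.ext fun A => ⟨fun h => ?_, fun h => ?_⟩, Set.ext fun A => ⟨fun h => ?_, fun h => ?_⟩,
    Set.ext fun A => ⟨fun h => ?_, fun h => ?_⟩⟩
  -- `Low` asks for an equality, and the inclusion `MLR {oracle A} ⊆ MLR ∅` holds for every `A`.
  · exact (MLR_anti (Set.empty_subset _)).antisymm (MLR_subset_of_partialMLR_subset h)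
  · exact (partialMLR_subset_MLR Z).trans (Eq.superset h)
  · exact MLR_subset_CR_of_partialMLR_subset h
  · exact (partialMLR_subset_MLR Z).trans h
  · exact MLR_subset_SR_of_partialMLR_subset h
  · exact (partialMLR_subset_MLR Z).trans h
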